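/- **Setting.** Let $a_1=1$ and $2(k+1)(4k^2+\tfrac54)a_{k+1}+(2k-1)a_k=0$ for $k\ge 1$, let $X_0(x)=\tfrac52+\sum_{k\ge1}a_kx^{2k}$ (an entire series), and let $h(x,y)=2X_0-xX_0'+y^2\,X_0'/x+\sqrt5$, where the analytic function $X_0'(x)/x$ takes the value $2$ at $x=0$. On $D=\{(x,y)\in\mathbb R^2: x>0\}$ put $$a_1=\tfrac{2y}{xh}\big(X_0+\tfrac{\sqrt5}2\big),\quad b_1=\tfrac{-1}{xh}\big(X_0+\tfrac{\sqrt5}2+\sqrt5(x^2-y^2)\big),\quad c_1=\tfrac{-2}{xh}\big(X_0+\tfrac{\sqrt5}2\big),$$ $$a_2=\tfrac{-1}{h}\big(2X_0+\sqrt5-(x^2+y^2)\tfrac{X_0'}x\big),\quad b_2=\tfrac{-2y}{h}\big(\tfrac{X_0'}{2x}+\sqrt5\big),\quad c_2=\tfrac{2y}{h}\big(X_0''-\tfrac{X_0'}x\big)$$ (here $a_1,a_2$ are functions on $D$, not coefficients of $X_0$). Let $F^0=[\phi,X^0_\alpha,X^0_\beta,\xi]$ be an orthonormal frame field of $\mathbb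 R^4$ on $D$ satisfying $dF^0=F^0\Omega$, that is, $$\partial_x\phi=-a_1X^0_\alpha,\quad \partial_xX^0_\alpha=a_1\phi-c_1X^0_\beta-b_1\xi,\quad \partial_xX^0_\beta=c_1X^0_\alpha,\quad \partial_x\xi=b_1X^0_\alpha,$$ $$\partial_y\phi=-a_2X^0_\beta,\quad \partial_yX^0_\alpha=c_2X^0_\beta,\quad \partial_yX^0_\beta=a_2\phi-c_2X^0_\alpha-b_2\xi,\quad \partial_y\xi=b_2X^0_\beta,$$ and let $f^0:D\to\mathbb R^4$ be a curvature surface determined by $F^0$: $df^0=\frac{x^2-y^2}{xh}X^0_\alpha\,dx+\frac{2y}{h}X^0_\beta\,dy$. Put $$\boldsymbol f(x,y)=\big((1+y^2)(5+4y^2)\big)^{-1/2}\big(X^0_\beta-2(1+y^2)\xi+y\phi\big)(x,y),\qquad r(y)=\frac1{2\sqrt5}\sqrt{\frac{5+4y^2}{1+y^2}},$$ $$v_2^0(y)=\frac{(5+4y^2)\big(X_0(0)+\frac{\sqrt5}2\big)-\sqrt5y^2}{\sqrt{5+4y^2}\;h(0,y)},\qquad v_3^0(y)=-\frac{2\sqrt5\,y^2}{h(0,y)}\sqrt{\frac{1+y^2}{5+4y^2}}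 .$$ **Theorem.** There are vectors $\boldsymbol b^\infty,\boldsymbol c^\infty\in\mathbb R^4$ and functions $\boldsymbol u,\boldsymbol v_1,A:\mathbb R\to\mathbb R^4$ such that for all $(x,y)\in D$: $(1+y^2)^{-1/2}(yX^0_\beta-\phi)(x,y)=\boldsymbol u(y)$, $f^0(x,y)=r(y)\boldsymbol f(x,y)+A(y)$, and $f^0(x,y)$ lies on the $2$-sphere $\mathbb S^2_y$ with center $A(y)$ and radius $r(y)$ in the affine hyperplane through $A(y)$ perpendicular to $\boldsymbol u(y)$; and, writing $$\boldsymbol b(u)=\cos(\tfrac{\sqrt5u}2)\boldsymbol b^\infty-\sin(\tfrac{\sqrt5u}2)\boldsymbol c^\infty,\qquad \boldsymbol v_2(u)=-\sin(\tfrac{\sqrt5u}2)\boldsymbol b^\infty-\cos(\tfrac{\sqrt5u}2)\boldsymbol c^\infty,$$ $$\boldsymbol a(u,y)=\tfrac2{\sqrt5}\big(-v^0_2(y)\boldsymbol v_1(y)+v_3^0(y)\boldsymbol v_2(u)\big),\qquad \Gamma(u,y)=r(y)\boldsymbol a(u,y)+A(y),$$ the following hold. 1. $\boldsymbol v_1$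 is continuous, $d\boldsymbol u/dy=\frac{y^2}{1+y^2}\boldsymbol v_1(y)$, and $[\boldsymbol u(y),\boldsymbol v_1(y),\boldsymbol b^\infty,\boldsymbol c^\infty]$ is orthonormal for every $y$ (so $\boldsymbol u$ moves on the unit circle of the plane perpendicular to $\boldsymbol b^\infty,\boldsymbol c^\infty$). 2. As $u\to\infty$, $X^0_\alpha(e^{-u},y)-\boldsymbol b(u)\to0$ and $\boldsymbol f(e^{-u},y)-\boldsymbol a(u,y)\to0$, uniformly in $y\in\mathbb R$. Here $\boldsymbol b$ runs through the unit circle centered at $0$ in the plane spanned by $\boldsymbol b^\infty,\boldsymbol c^\infty$, and $\boldsymbol a(\cdot,y)$ runs through the circle with center $-\frac2{\sqrt5}v_2^0(y)\boldsymbol v_1(y)$ and radius $\frac2{\sqrt5}|v_3^0(y)|$ in a plane parallel to that one. The curves $\boldsymbol a(\cdot,y)$ depend continuously on $y$ (uniformly in $u$), and $\boldsymbol a(u,0)=-\boldsymbol v_1(0)$ for all $u$. 3. As $u\to\infty$, $f^0(e^{-u},y)-\Gamma(u,y)\to0$, uniformly in $y\in\mathbb R$. For each $y$, $\Gamma(\cdot,y)$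 runs through the circle with center $A(y)-\frac{2}{\sqrt5}r(y)v_2^0(y)\boldsymbol v_1(y)$ and radius $\frac{2y^2}{\sqrt5\,h(0,y)}$ in a plane parallel to $\boldsymbol b^\infty,\boldsymbol c^\infty$, and this circle lies in $\mathbb S^2_y$. The curves $\Gamma(\cdot,y)$ depend continuously on $y$ (uniformly in $u$), and $\Gamma(u,0)=-\frac12\boldsymbol v_1(0)+A(0)$ for all $u$, so that the circle degenerates to a point at $y=0$. (A circle of radius $0$ is a point.) -/

import Mathlib

open Set Filter Topology

namespace CurvSurf

noncomputable section

/-- Euclidean 4-space. -/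
abbrev E4 := EuclideanSpace ℝ (Fin 4)

/-- The coefficients of `X₀`: `a₁ = 1` and `2 (k+1) (4 k² + 5/4) a_{k+1} + (2 k - 1) a_k = 0`.
Starting the same recursion at `a₀ = 5/2` gives `a₁ = 1`. -/
def coeffX : ℕ → ℝ
  | 0 => 5 / 2
  | k + 1 => -((2 * (k : ℝ) - 1) / (2 * ((k : ℝ) + 1) * (4 * (k : ℝ) ^ 2 + 5 / 4))) * coeffX k

theorem coeffX_one : coeffX 1 = 1 := by
  norm_num [coeffX]

theorem coeffX_rec (k : ℕ) :
    2 * ((k : ℝ) + 1) * (4 * (k : ℝ) ^ 2 + 5 / 4) * coeffX (k + 1)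
      + (2 * (k : ℝ) - 1) * coeffX k = 0 := by
  have h1 : ((k : ℝ) + 1) ≠ 0 := by positivity
  have h2 : (4 * (k : ℝ) ^ 2 + 5 / 4) ≠ 0 := by positivity
  simp only [coeffX]
  field_simp
  ring

/-- `X₀(x) = 5/2 + ∑_{k ≥ 1} a_k x^{2k}`; the series converges for every real `x`. -/
def X0 (x : ℝ) : ℝ := ∑' k : ℕ, coeffX k * x ^ (2 * k)

/-- The analytic function `X₀'(x) / x`, whose value at `0` is `2`. -/
def X0q (x : ℝ) : ℝ := if x = 0 then 2 else deriv X0 x / x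

/-- `h = 2 X₀ - x X₀' + y² (X₀'/x) + √5`. -/
def h (x y : ℝ) : ℝ := 2 * X0 x - x * deriv X0 x + y ^ 2 * X0q x + √5

def a₁ (x y : ℝ) : ℝ := 2 * y / (x * h x y) * (X0 x + √5 / 2)
def b₁ (x y : ℝ) : ℝ := -1 / (x * h x y) * (X0 x + √5 / 2 + √5 * (x ^ 2 - y ^ 2))
def c₁ (x y : ℝ) : ℝ := -2 / (x * h x y) * (X0 x + √5 / 2)
def a₂ (x y : ℝ) : ℝ := -1 / h x y * (2 * X0 x + √5 - (x ^ 2 + y ^ 2) * X0q x)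
def b₂ (x y : ℝ) : ℝ := -2 * y / h x y * (X0q x / 2 + √5)
def c₂ (x y : ℝ) : ℝ := 2 * y / h x y * (deriv (deriv X0) x - X0q x)

/-- The connection form is `Ω = Ω₁ dx + Ω₂ dy`. -/
def Ω₁ (x y : ℝ) : Matrix (Fin 4) (Fin 4) ℝ :=
  !![0, a₁ x y, 0, 0;
     -a₁ x y, 0, c₁ x y, b₁ x y;
     0, -c₁ x y, 0, 0;
     0, -b₁ x y, 0, 0]

def Ω₂ (x y : ℝ) : Matrix (Fin 4) (Fin 4) ℝ :=
  !![0, 0, a₂ x y, 0;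
     0, 0, -c₂ x y, 0;
     -a₂ x y, c₂ x y, 0, b₂ x y;
     0, 0, -b₂ x y, 0]

/-- `F = [φ, X_α, X_β, ξ]`, with columns `F x y 0, …, F x y 3`, is an orthonormal frame field on
`D = {x > 0}` that solves the structure equation `dF = F Ω`. -/
structure IsFrameField (F : ℝ → ℝ → Fin 4 → E4) : Prop where
  orthonormal : ∀ x y : ℝ, 0 < x → Orthonormal ℝ (F x y)
  deriv_x : ∀ x y : ℝ, 0 < x → ∀ j : Fin 4,
    HasDerivAt (fun s : ℝ => F s y j) (∑ i : Fin 4, Ω₁ x y i j • F x y i) x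
  deriv_y : ∀ x y : ℝ, 0 < x → ∀ j : Fin 4,
    HasDerivAt (fun s : ℝ => F x s j) (∑ i : Fin 4, Ω₂ x y i j • F x y i) y

/-- `f` is a curvature surface on `D = {x > 0}` determined by the frame field `F`:
`df = ((x² - y²) / (x h)) X_α dx + (2 y / h) X_β dy`. -/
structure IsCurvatureSurface (F : ℝ → ℝ → Fin 4 → E4) (f : ℝ → ℝ → E4) : Prop where
  frame : IsFrameField F
  deriv_x : ∀ x y : ℝ, 0 < x →
    HasDerivAt (fun s : ℝ => f s y) (((x ^ 2 - y ^ 2) / (x * h x y)) • F x y 1) x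
  deriv_y : ∀ x y : ℝ, 0 < x →
    HasDerivAt (fun s : ℝ => f x s) ((2 * y / h x y) • F x y 2) y

/-- `(1 + y²)^{-1/2} (y X_β - φ)(x, y)`. -/
def uVec (F : ℝ → ℝ → Fin 4 → E4) (x y : ℝ) : E4 :=
  (√(1 + y ^ 2))⁻¹ • (y • F x y 2 - F x y 0)

/-- `((1 + y²)(5 + 4y²))^{-1/2} (X_β - 2 (1 + y²) ξ + y φ)(x, y)`. -/
def fVec (F : ℝ → ℝ → Fin 4 → E4) (x y : ℝ) : E4 :=
  (√((1 + y ^ 2) * (5 + 4 * y ^ 2)))⁻¹ •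
    (F x y 2 - (2 * (1 + y ^ 2)) • F x y 3 + y • F x y 0)

/-- The radius of the 2-sphere that contains the `x`-curve with parameter `y`. -/
def radS (y : ℝ) : ℝ := (2 * √5)⁻¹ * √((5 + 4 * y ^ 2) / (1 + y ^ 2))

/-- The 2-sphere with center `A` and radius `r` in the affine hyperplane through `A`
perpendicular to `u`. -/
def sphere2 (A u : E4) (r : ℝ) : Set E4 := {p | dist p A = r ∧ inner ℝ (p - A) u = 0}

/-- The circle with center `c` and radius `r` in the plane through `c` with directions `b₀`, `c₀`
(the point `c` if `r = 0`). -/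
def planeCircle (b₀ c₀ c : E4) (r : ℝ) : Set E4 :=
  {p | dist p c = r ∧ p - c ∈ Submodule.span ℝ {b₀, c₀}}

def v2 (x y : ℝ) : ℝ :=
  (√(5 + 4 * y ^ 2))⁻¹ * (h x y)⁻¹ *
    ((5 + 4 * y ^ 2) * (X0 x + √5 / 2) + √5 * (x ^ 2 - y ^ 2))

def v3 (x y : ℝ) : ℝ :=
  2 * √5 * (x ^ 2 - y ^ 2) * (h x y)⁻¹ * √((1 + y ^ 2) / (5 + 4 * y ^ 2))

/-- `b(t) = cos(√5 t / 2) b^∞ - sin(√5 t / 2) c^∞`. -/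
def bCirc (bInf cInf : E4) (t : ℝ) : E4 :=
  Real.cos (√5 * t / 2) • bInf - Real.sin (√5 * t / 2) • cInf

/-- `v₂(t) = - sin(√5 t / 2) b^∞ - cos(√5 t / 2) c^∞`. -/
def v2Circ (bInf cInf : E4) (t : ℝ) : E4 :=
  -(Real.sin (√5 * t / 2) • bInf) - Real.cos (√5 * t / 2) • cInf

/-- `a(t, y) = (2/√5) (- v₂(0, y) v₁(y) + v₃(0, y) v₂(t))`. -/
def aCirc (bInf cInf : E4) (v₁ : ℝ → E4) (t y : ℝ) : E4 :=
  (2 / √5) • (-(v2 0 y • v₁ y) + v3 0 y • v2Circ bInf cInf t)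

/-- `Γ(t, y) = radS(y) a(t, y) + A(y)`. -/
def Γ (bInf cInf : E4) (v₁ A : ℝ → E4) (t y : ℝ) : E4 :=
  radS y • aCirc bInf cInf v₁ t y + A y

/-- As `t → ∞`, every `t`-curve `M(·, y)` converges uniformly to `N(·, y)`, uniformly with respect
to `y ∈ ℝ`. -/
def ConvergesUniformly (M N : ℝ → ℝ → E4) : Prop :=
  ∀ ε : ℝ, 0 < ε → ∃ T : ℝ, ∀ t : ℝ, T < t → ∀ y : ℝ, ‖M t y - N t y‖ < ε

/-- The parametrized curves `N(·, y)` depend continuously on `y`, in the topology of uniform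
convergence on `ℝ`. -/
def DeformsContinuously (N : ℝ → ℝ → E4) : Prop :=
  ∀ y₀ : ℝ, TendstoUniformly (fun y t => N t y) (fun t => N t y₀) (𝓝 y₀)

end

end CurvSurf

open CurvSurf

namespace CurvSurf

noncomputable section

/-- The coefficients `c` define an entire power series. -/
def IsEntire (c : ℕ → ℝ) : Prop := ∀ r : ℝ, Summable fun k => |c k| * |r| ^ k

/-- The sum of the power series with coefficients `c`. -/
def powerSum (c : ℕ → ℝ) (s : ℝ) : ℝ := ∑' k, c k * s ^ k

theorem IsEntire.summable {c : ℕ → ℝ} (hc : IsEntire c) (s : ℝ) :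
    Summable fun k => c k * s ^ k := by
  refine Summable.of_norm ?_
  simpa [abs_mul, abs_pow] using hc s

theorem IsEntire.nat_mul {c : ℕ → ℝ} (hc : IsEntire c) : IsEntire fun k => k * c k := by
  intro r
  refine Summable.of_nonneg_of_le (fun k => by positivity) (fun k => ?_) (hc (2 * r))
  have hk : (k : ℝ) ≤ 2 ^ k := by exact_mod_cast (Nat.lt_two_pow_self).le
  rw [abs_mul, abs_mul, mul_pow, Nat.abs_cast, abs_two]
  calc (k : ℝ) * |c k| * |r| ^ k ≤ 2 ^ k * |c k| * |r| ^ k := by gcongr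
    _ = |c k| * (2 ^ k * |r| ^ k) := by ring

theorem IsEntire.shift {c : ℕ → ℝ} (hc : IsEntire c) : IsEntire fun k => c (k + 1) := by
  intro r
  have h1 := (summable_nat_add_iff (f := fun k => |c k| * |(|r| + 1)| ^ k) 1).2 (hc (|r| + 1))
  refine Summable.of_nonneg_of_le (fun k => by positivity) (fun k => ?_) h1
  have h0 : (0 : ℝ) ≤ |r| := abs_nonneg r
  rw [abs_of_nonneg (by positivity : (0 : ℝ) ≤ |r| + 1)]
  gcongr
  calc |r| ^ k ≤ (|r| + 1) ^ k := by gcongr; linarith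
    _ ≤ (|r| + 1) ^ (k + 1) := pow_le_pow_right₀ (by linarith) (by omega)

theorem IsEntire.deriv {c : ℕ → ℝ} (hc : IsEntire c) :
    IsEntire fun k => ((k : ℝ) + 1) * c (k + 1) := by
  simpa using hc.nat_mul.shift

theorem IsEntire.const_mul {c : ℕ → ℝ} (hc : IsEntire c) (r : ℝ) :
    IsEntire fun k => r * c k := by
  intro s
  simpa [abs_mul, mul_assoc] using (hc s).mul_left |r|

theorem IsEntire.hasDerivAt {c : ℕ → ℝ} (hc : IsEntire c) (s : ℝ) :
    HasDerivAt (powerSum c) (powerSum (fun k => ((k : ℝ) + 1) * c (k + 1)) s) s := by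
  have key := hasDerivAt_tsum_of_isPreconnected (𝕜 := ℝ)
    (g := fun (k : ℕ) (s : ℝ) => c k * s ^ k)
    (g' := fun (k : ℕ) (s : ℝ) => c k * (k * s ^ (k - 1)))
    (u := fun k : ℕ => |(k : ℝ) * c k| * |(|s| + 1)| ^ k) (t := Metric.ball 0 (|s| + 1)) (y₀ := s)
    (y := s) (hc.nat_mul _) Metric.isOpen_ball (convex_ball _ _).isPreconnected
    (fun k y _ => (hasDerivAt_pow k y).const_mul (c k))
    (fun k y hy => ?_) (by simp) (hc.summable s) (by simp)
  · have e : (∑' k : ℕ, c k * (k * s ^ (k - 1)))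
        = powerSum (fun k => ((k : ℝ) + 1) * c (k + 1)) s := by
      have hs : Summable fun k : ℕ => c k * ((k : ℝ) * s ^ (k - 1)) := by
        rw [← summable_nat_add_iff 1]
        refine (hc.deriv.summable s).congr fun k => ?_
        push_cast
        ring
      rw [hs.tsum_eq_zero_add, powerSum]
      simp only [Nat.cast_zero, zero_mul, mul_zero, zero_add]
      refine tsum_congr fun k => ?_
      push_cast
      ring
    rw [← e]
    exact key
  · have h0 : (0 : ℝ) ≤ |s| := abs_nonneg s
    have hy' : |y| ≤ |s| + 1 := by simpa using (Metric.mem_ball.1 hy).le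
    rw [Real.norm_eq_abs, abs_mul, abs_mul, abs_mul, abs_pow,
      abs_of_nonneg (by positivity : (0 : ℝ) ≤ |s| + 1)]
    rcases k with _ | k
    · simp
    · calc |c (k + 1)| * (|((k + 1 : ℕ) : ℝ)| * |y| ^ (k + 1 - 1))
          ≤ |c (k + 1)| * (|((k + 1 : ℕ) : ℝ)| * (|s| + 1) ^ (k + 1)) := by
            gcongr
            calc |y| ^ (k + 1 - 1) ≤ (|s| + 1) ^ k := by
                  simp only [Nat.add_sub_cancel]; gcongr
              _ ≤ (|s| + 1) ^ (k + 1) := pow_le_pow_right₀ (by linarith) (by omega)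
        _ = _ := by ring

theorem IsEntire.mul_powerSum_deriv {c : ℕ → ℝ} (hc : IsEntire c) (s : ℝ) :
    s * powerSum (fun k => ((k : ℝ) + 1) * c (k + 1)) s = powerSum (fun k => k * c k) s := by
  rw [powerSum, powerSum, (hc.nat_mul.summable s).tsum_eq_zero_add, ← tsum_mul_left]
  simp only [Nat.cast_zero, zero_mul, zero_add]
  refine tsum_congr fun k => ?_
  push_cast
  ring

theorem powerSum_zero (c : ℕ → ℝ) : powerSum c 0 = c 0 := by
  rw [powerSum, tsum_eq_single 0]
  · simp
  · intro k hk
    simp [hk]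

theorem abs_coeffX_le (k : ℕ) : |coeffX k| ≤ 5 / 2 / k.factorial := by
  induction k with
  | zero => simp [coeffX, abs_of_pos]
  | succ k ih =>
    have e : |coeffX (k + 1)|
        = |2 * (k : ℝ) - 1| / (2 * ((k : ℝ) + 1) * (4 * (k : ℝ) ^ 2 + 5 / 4)) * |coeffX k| := by
      rw [coeffX, abs_mul, abs_neg, abs_div,
        abs_of_pos (by positivity : 0 < 2 * ((k : ℝ) + 1) * (4 * (k : ℝ) ^ 2 + 5 / 4))]
    have b : |2 * (k : ℝ) - 1| / (2 * ((k : ℝ) + 1) * (4 * (k : ℝ) ^ 2 + 5 / 4))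
        ≤ 1 / ((k : ℝ) + 1) := by
      rw [div_le_div_iff₀ (by positivity) (by positivity)]
      have h1 : |2 * (k : ℝ) - 1| ≤ 2 * (4 * (k : ℝ) ^ 2 + 5 / 4) := by
        rw [abs_le]
        constructor <;> nlinarith [sq_nonneg (2 * (k : ℝ) - 1), sq_nonneg (2 * (k : ℝ) + 1)]
      have h2 : (0 : ℝ) ≤ (k : ℝ) + 1 := by positivity
      nlinarith [mul_le_mul_of_nonneg_right h1 h2]
    calc |coeffX (k + 1)| ≤ 1 / ((k : ℝ) + 1) * (5 / 2 / k.factorial) := by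
          rw [e]; gcongr
      _ = 5 / 2 / (k + 1).factorial := by
          rw [Nat.factorial_succ]; push_cast; field_simp

theorem isEntire_coeffX : IsEntire coeffX := by
  intro r
  refine Summable.of_nonneg_of_le (fun k => by positivity) (fun k => ?_)
    ((Real.summable_pow_div_factorial |r|).mul_left (5 / 2))
  calc |coeffX k| * |r| ^ k ≤ 5 / 2 / k.factorial * |r| ^ k := by
        gcongr; exact abs_coeffX_le k
    _ = 5 / 2 * (|r| ^ k / k.factorial) := by ring

theorem X0_eq (x : ℝ) : X0 x = powerSum coeffX (x ^ 2) := by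
  simp only [X0, powerSum, pow_mul]

/-- The coefficients of `X₀'(x) / x` as a power series in `x²`. -/
def coeffQ (k : ℕ) : ℝ := 2 * (((k : ℝ) + 1) * coeffX (k + 1))

theorem isEntire_coeffQ : IsEntire coeffQ := isEntire_coeffX.deriv.const_mul 2

/-- The coefficients of `x (X₀'(x) / x)'` as a power series in `x²`. -/
def coeffP (k : ℕ) : ℝ := 2 * (k * coeffQ k)

theorem isEntire_coeffP : IsEntire coeffP := isEntire_coeffQ.nat_mul.const_mul 2

theorem powerSum_const_mul (r : ℝ) (c : ℕ → ℝ) (s : ℝ) :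
    powerSum (fun k => r * c k) s = r * powerSum c s := by
  simp only [powerSum, mul_assoc, tsum_mul_left]

theorem hasDerivAt_powerSum_coeffX (s : ℝ) :
    HasDerivAt (powerSum coeffX) (powerSum coeffQ s / 2) s := by
  refine (isEntire_coeffX.hasDerivAt s).congr_deriv ?_
  rw [show coeffQ = fun k : ℕ => 2 * (((k : ℝ) + 1) * coeffX (k + 1)) from rfl,
    powerSum_const_mul 2 (fun k : ℕ => ((k : ℝ) + 1) * coeffX (k + 1))]
  ring

theorem powerSum_coeffP (s : ℝ) :
    powerSum coeffP s = 2 * (s * deriv (powerSum coeffQ) s) := by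
  rw [(isEntire_coeffQ.hasDerivAt s).deriv, isEntire_coeffQ.mul_powerSum_deriv]
  exact powerSum_const_mul 2 (fun k => k * coeffQ k) s

theorem powerSum_ode (s : ℝ) :
    2 * (s * deriv (powerSum coeffP) s)
      = powerSum coeffX s - (s + 5 / 4) * powerSum coeffQ s := by
  have h1 := isEntire_coeffX.mul_powerSum_deriv s
  have h2 : s * powerSum coeffQ s = 2 * powerSum (fun k => k * coeffX k) s := by
    rw [← h1, show coeffQ = fun k : ℕ => 2 * (((k : ℝ) + 1) * coeffX (k + 1)) from rfl,
      powerSum_const_mul 2 (fun k : ℕ => ((k : ℝ) + 1) * coeffX (k + 1))]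
    ring
  rw [(isEntire_coeffP.hasDerivAt s).deriv, isEntire_coeffP.mul_powerSum_deriv, add_mul, h2]
  simp only [powerSum, ← tsum_mul_left]
  rw [← Summable.tsum_add ((isEntire_coeffX.nat_mul.summable s).mul_left 2)
    ((isEntire_coeffQ.summable s).mul_left (5 / 4)),
    ← Summable.tsum_sub (isEntire_coeffX.summable s)
      (((isEntire_coeffX.nat_mul.summable s).mul_left 2).add
        ((isEntire_coeffQ.summable s).mul_left (5 / 4)))]
  refine tsum_congr fun k => ?_
  simp only [coeffP, coeffQ]
  linear_combination s ^ k * coeffX_rec k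

theorem powerSum_first_integral (s : ℝ) :
    powerSum coeffP s ^ 2 - 2 * powerSum coeffX s * powerSum coeffQ s
      + (s + 5 / 4) * powerSum coeffQ s ^ 2 = -5 := by
  set I : ℝ → ℝ := fun s => powerSum coeffP s ^ 2 - 2 * powerSum coeffX s * powerSum coeffQ s
      + (s + 5 / 4) * powerSum coeffQ s ^ 2 with hI
  have hd : ∀ s, HasDerivAt I 0 s := by
    intro s
    have hP := (isEntire_coeffP.hasDerivAt s).differentiableAt.hasDerivAt
    have hQ := (isEntire_coeffQ.hasDerivAt s).differentiableAt.hasDerivAt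
    have hX := hasDerivAt_powerSum_coeffX s
    have := ((hP.pow 2).sub ((hX.const_mul 2).mul hQ)).add
      (((hasDerivAt_id s).add_const (5 / 4)).mul (hQ.pow 2))
    refine this.congr_deriv ?_
    simp only [Nat.cast_ofNat, id, Pi.pow_apply]
    have e1 := powerSum_ode s
    have e2 := powerSum_coeffP s
    simp only [Nat.add_one_sub_one, pow_one]
    rw [e2]
    linear_combination 2 * deriv (powerSum coeffQ) s * e1
  have hc : I s = I 0 := is_const_of_deriv_eq_zero (fun s => (hd s).differentiableAt)
    (fun s => (hd s).deriv) s 0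
  have h0 : I 0 = -5 := by
    simp only [hI, powerSum_zero, coeffP, coeffQ]
    norm_num [coeffX]
  exact hc.trans h0

theorem hasDerivAt_X0 (x : ℝ) : HasDerivAt X0 (x * powerSum coeffQ (x ^ 2)) x := by
  have h1 := (hasDerivAt_powerSum_coeffX (x ^ 2)).comp x (hasDerivAt_pow 2 x)
  rw [show X0 = powerSum coeffX ∘ fun x => x ^ 2 from funext X0_eq]
  refine h1.congr_deriv ?_
  simp
  ring

theorem X0q_eq (x : ℝ) : X0q x = powerSum coeffQ (x ^ 2) := by
  rw [X0q]
  split_ifs with hx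
  · subst hx
    norm_num [powerSum_zero, coeffQ, coeffX_one]
  · rw [(hasDerivAt_X0 x).deriv]
    field_simp

/-- The function `X₀'' - X₀' / x`. -/
def X0p (x : ℝ) : ℝ := deriv (deriv X0) x - X0q x

theorem X0p_eq (x : ℝ) : X0p x = powerSum coeffP (x ^ 2) := by
  have h1 := ((isEntire_coeffQ.hasDerivAt (x ^ 2)).differentiableAt.hasDerivAt).comp x
    (hasDerivAt_pow 2 x)
  have h2 : HasDerivAt (deriv X0) (powerSum coeffQ (x ^ 2) + powerSum coeffP (x ^ 2)) x := by
    rw [show deriv X0 = fun x => x * powerSum coeffQ (x ^ 2) from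
      funext fun x => (hasDerivAt_X0 x).deriv]
    refine ((hasDerivAt_id x).mul h1).congr_deriv ?_
    rw [powerSum_coeffP]
    simp
    ring
  rw [X0p, h2.deriv, X0q_eq]
  ring

theorem first_integral (x : ℝ) :
    X0p x ^ 2 - 2 * X0 x * X0q x + (x ^ 2 + 5 / 4) * X0q x ^ 2 = -5 := by
  rw [X0p_eq, X0q_eq, X0_eq]
  exact powerSum_first_integral (x ^ 2)

theorem IsEntire.continuous {c : ℕ → ℝ} (hc : IsEntire c) :
    Continuous fun x : ℝ => powerSum c (x ^ 2) :=
  (continuous_iff_continuousAt.2 fun s => (hc.hasDerivAt s).continuousAt).comp (continuous_pow 2)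

theorem continuous_X0 : Continuous X0 := by
  rw [funext X0_eq]; exact isEntire_coeffX.continuous

theorem continuous_X0q : Continuous X0q := by
  rw [funext X0q_eq]; exact isEntire_coeffQ.continuous

theorem continuous_X0p : Continuous X0p := by
  rw [funext X0p_eq]; exact isEntire_coeffP.continuous

theorem X0_zero : X0 0 = 5 / 2 := by
  rw [X0_eq]; norm_num [powerSum_zero, coeffX]

theorem X0q_zero : X0q 0 = 2 := by simp [X0q]

theorem X0p_zero : X0p 0 = 0 := by
  rw [X0p_eq]; norm_num [powerSum_zero, coeffP]

theorem h_eq (x y : ℝ) : h x y = 2 * X0 x - x ^ 2 * X0q x + y ^ 2 * X0q x + √5 := by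
  rw [h, (hasDerivAt_X0 x).deriv, X0q_eq]
  ring

theorem h_zero (y : ℝ) : h 0 y = 5 + √5 + 2 * y ^ 2 := by
  rw [h_eq, X0_zero, X0q_zero]
  ring

theorem X0q_mul_h (x y : ℝ) : X0q x * h x y
    = X0p x ^ 2 + (5 / 4 + y ^ 2) * X0q x ^ 2 + 5 + √5 * X0q x := by
  rw [h_eq]
  linear_combination -first_integral x

theorem le_h {x : ℝ} (hq : 0 < X0q x) (y : ℝ) : X0q x * (1 + y ^ 2) ≤ h x y := by
  refine le_of_mul_le_mul_left ?_ hq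
  rw [X0q_mul_h]
  have : 0 ≤ √5 * X0q x := by positivity
  nlinarith [sq_nonneg (X0p x), sq_nonneg (X0q x)]

/-- The unit vector `(1 + y²)^{-1/2} (X_β + y φ)`. -/
def wVec (F : ℝ → ℝ → Fin 4 → E4) (x y : ℝ) : E4 :=
  (√(1 + y ^ 2))⁻¹ • (F x y 2 + y • F x y 0)

/-- The `w`-component of `vVec`. -/
def mC (x y : ℝ) : ℝ := 2 * X0q x * (1 + y ^ 2) / h x y - 1

/-- The negative of the `X_α`-component of `vVec`. -/
def nC (x y : ℝ) : ℝ := 2 * X0p x * √(1 + y ^ 2) / h x y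

/-- The `ξ`-component of `vVec`. -/
def kC (x y : ℝ) : ℝ := (X0q x + 2 * √5) * √(1 + y ^ 2) / h x y

/-- The unit vector that is proportional to `∂u/∂y`. -/
def vVec (F : ℝ → ℝ → Fin 4 → E4) (x y : ℝ) : E4 :=
  mC x y • wVec F x y - nC x y • F x y 1 + kC x y • F x y 3

/-- The part of `X_α` perpendicular to `vVec`. -/
def bVec (F : ℝ → ℝ → Fin 4 → E4) (x y : ℝ) : E4 := F x y 1 + nC x y • vVec F x y

/-- A vector perpendicular to `uVec`, `vVec` and `bVec`. -/
def nVec (F : ℝ → ℝ → Fin 4 → E4) (x y : ℝ) : E4 :=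
  kC x y • wVec F x y - mC x y • F x y 3

theorem sq_sqrt_one_add (y : ℝ) : √(1 + y ^ 2) ^ 2 = 1 + y ^ 2 :=
  Real.sq_sqrt (by positivity)

theorem sqrt_one_add_pos (y : ℝ) : 0 < √(1 + y ^ 2) := Real.sqrt_pos.2 (by positivity)

theorem sqrt_five_sq : √5 ^ 2 = (5 : ℝ) := Real.sq_sqrt (by norm_num)

theorem h_pos {x : ℝ} (hq : 0 < X0q x) (y : ℝ) : 0 < h x y :=
  lt_of_lt_of_le (by positivity) (le_h hq y)

theorem hasDerivAt_sqrt_one_add (y : ℝ) :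
    HasDerivAt (fun s : ℝ => √(1 + s ^ 2)) (y / √(1 + y ^ 2)) y := by
  have h1 : HasDerivAt (fun s : ℝ => 1 + s ^ 2) (2 * y) y := by
    refine ((hasDerivAt_pow 2 y).const_add 1).congr_deriv ?_
    simp
  refine (h1.sqrt (by positivity)).congr_deriv ?_
  ring

theorem hasDerivAt_h (x y : ℝ) : HasDerivAt (fun s : ℝ => h x s) (2 * y * X0q x) y := by
  rw [funext (h_eq x)]
  refine ((((hasDerivAt_pow 2 y).mul_const (X0q x)).const_add _).add_const (√5)).congr_deriv ?_
  simp

theorem m_sq_add {x : ℝ} (hq : 0 < X0q x) (y : ℝ) :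
    mC x y ^ 2 + nC x y ^ 2 + kC x y ^ 2 = 1 := by
  have hh := (h_pos hq y).ne'
  have e : (2 * X0q x * (1 + y ^ 2) - h x y) ^ 2
      + (1 + y ^ 2) * (4 * X0p x ^ 2 + (X0q x + 2 * √5) ^ 2) = h x y ^ 2 := by
    linear_combination -4 * (1 + y ^ 2) * X0q_mul_h x y + 4 * (1 + y ^ 2) * sqrt_five_sq
  have e1 : mC x y = (2 * X0q x * (1 + y ^ 2) - h x y) / h x y := by
    rw [mC]; field_simp
  rw [e1, nC, kC, div_pow, div_pow, div_pow, ← add_div, ← add_div,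
    div_eq_one_iff_eq (by positivity), ← e, mul_pow _ (√(1 + y ^ 2)), mul_pow _ (√(1 + y ^ 2)),
    sq_sqrt_one_add]
  ring

theorem hasDerivAt_mC {x : ℝ} (hq : 0 < X0q x) (y : ℝ) :
    HasDerivAt (mC x) (y / (1 + y ^ 2) * (nC x y ^ 2 + kC x y ^ 2)) y := by
  have hh := (h_pos hq y).ne'
  have h1 : HasDerivAt (fun s : ℝ => 2 * X0q x * (1 + s ^ 2)) (2 * X0q x * (2 * y)) y := by
    refine (((hasDerivAt_pow 2 y).const_add 1).const_mul _).congr_deriv ?_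
    simp
  refine ((h1.div (hasDerivAt_h x y) hh).sub_const 1).congr_deriv ?_
  have e : nC x y ^ 2 + kC x y ^ 2 = 1 - mC x y ^ 2 := by
    linear_combination m_sq_add hq y
  rw [e, mC]
  field_simp
  ring

theorem hasDerivAt_nC {x : ℝ} (hq : 0 < X0q x) (y : ℝ) :
    HasDerivAt (nC x) (-(y / (1 + y ^ 2) * (mC x y * nC x y))) y := by
  have hh := (h_pos hq y).ne'
  have hr := (sqrt_one_add_pos y).ne'
  refine (((hasDerivAt_sqrt_one_add y).const_mul (2 * X0p x)).div
    (hasDerivAt_h x y) hh).congr_deriv ?_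
  have hs := sq_sqrt_one_add y
  rw [nC, mC]
  generalize √(1 + y ^ 2) = r at *
  rw [← hs]
  field_simp
  ring

theorem hasDerivAt_kC {x : ℝ} (hq : 0 < X0q x) (y : ℝ) :
    HasDerivAt (kC x) (-(y / (1 + y ^ 2) * (mC x y * kC x y))) y := by
  have hh := (h_pos hq y).ne'
  have hr := (sqrt_one_add_pos y).ne'
  refine (((hasDerivAt_sqrt_one_add y).const_mul (X0q x + 2 * √5)).div
    (hasDerivAt_h x y) hh).congr_deriv ?_
  have hs := sq_sqrt_one_add y
  rw [kC, mC]
  generalize √(1 + y ^ 2) = r at *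
  rw [← hs]
  field_simp
  ring

theorem a₂_eq {x : ℝ} (hq : 0 < X0q x) (y : ℝ) : a₂ x y = 2 * y ^ 2 * X0q x / h x y - 1 := by
  have hh := (h_pos hq y).ne'
  rw [a₂]
  field_simp
  rw [h_eq]
  ring

theorem b₂_eq (x y : ℝ) : b₂ x y = -(y * (X0q x + 2 * √5) / h x y) := by
  rw [b₂]; ring

theorem c₂_eq (x y : ℝ) : c₂ x y = 2 * y * X0p x / h x y := by
  rw [c₂, X0p]; ring

theorem IsFrameField.hasDerivAt_φ {F : ℝ → ℝ → Fin 4 → E4} (hF : IsFrameField F) {x : ℝ}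
    (hx : 0 < x) (y : ℝ) :
    HasDerivAt (fun s => F x s 0) (-(a₂ x y • F x y 2)) y := by
  refine (hF.deriv_y x y hx 0).congr_deriv ?_
  simp [Fin.sum_univ_four, Ω₂]

theorem IsFrameField.hasDerivAt_Xα {F : ℝ → ℝ → Fin 4 → E4} (hF : IsFrameField F) {x : ℝ}
    (hx : 0 < x) (y : ℝ) :
    HasDerivAt (fun s => F x s 1) (c₂ x y • F x y 2) y := by
  refine (hF.deriv_y x y hx 1).congr_deriv ?_
  simp [Fin.sum_univ_four, Ω₂]

theorem IsFrameField.hasDerivAt_Xβ {F : ℝ → ℝ → Fin 4 → E4} (hF : IsFrameField F) {x : ℝ}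
    (hx : 0 < x) (y : ℝ) :
    HasDerivAt (fun s => F x s 2) (a₂ x y • F x y 0 - c₂ x y • F x y 1 - b₂ x y • F x y 3) y := by
  refine (hF.deriv_y x y hx 2).congr_deriv ?_
  simp [Fin.sum_univ_four, Ω₂]
  abel

theorem IsFrameField.hasDerivAt_ξ {F : ℝ → ℝ → Fin 4 → E4} (hF : IsFrameField F) {x : ℝ}
    (hx : 0 < x) (y : ℝ) :
    HasDerivAt (fun s => F x s 3) (b₂ x y • F x y 2) y := by
  refine (hF.deriv_y x y hx 3).congr_deriv ?_
  simp [Fin.sum_univ_four, Ω₂]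

theorem Xβ_eq (F : ℝ → ℝ → Fin 4 → E4) (x y : ℝ) :
    F x y 2 = (√(1 + y ^ 2))⁻¹ • (wVec F x y + y • uVec F x y) := by
  have hr := (sqrt_one_add_pos y).ne'
  have hs := sq_sqrt_one_add y
  rw [wVec, uVec]
  match_scalars
  · field_simp
    linear_combination hs
  · field_simp
    ring

theorem IsFrameField.hasDerivAt_Xα_y {F : ℝ → ℝ → Fin 4 → E4} (hF : IsFrameField F) {x : ℝ}
    (hx : 0 < x) (hq : 0 < X0q x) (y : ℝ) :
    HasDerivAt (fun s => F x s 1)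
      ((y / (1 + y ^ 2) * nC x y) • wVec F x y + (y ^ 2 / (1 + y ^ 2) * nC x y) • uVec F x y) y := by
  have hh := (h_pos hq y).ne'
  have hr := (sqrt_one_add_pos y).ne'
  refine (hF.hasDerivAt_Xα hx y).congr_deriv ?_
  rw [Xβ_eq F, c₂_eq, nC]
  have hs := sq_sqrt_one_add y
  generalize √(1 + y ^ 2) = r at *
  rw [← hs]
  match_scalars <;> field_simp

theorem IsFrameField.hasDerivAt_ξ_y {F : ℝ → ℝ → Fin 4 → E4} (hF : IsFrameField F) {x : ℝ}
    (hx : 0 < x) (hq : 0 < X0q x) (y : ℝ) :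
    HasDerivAt (fun s => F x s 3)
      (-((y / (1 + y ^ 2) * kC x y) • wVec F x y + (y ^ 2 / (1 + y ^ 2) * kC x y) • uVec F x y))
      y := by
  have hh := (h_pos hq y).ne'
  have hr := (sqrt_one_add_pos y).ne'
  refine (hF.hasDerivAt_ξ hx y).congr_deriv ?_
  rw [Xβ_eq F, b₂_eq, kC]
  have hs := sq_sqrt_one_add y
  generalize √(1 + y ^ 2) = r at *
  rw [← hs]
  match_scalars <;> field_simp

theorem hasDerivAt_inv_sqrt_one_add (y : ℝ) :
    HasDerivAt (fun s : ℝ => (√(1 + s ^ 2))⁻¹) (-(y / √(1 + y ^ 2) ^ 3)) y := by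
  have hr := (sqrt_one_add_pos y).ne'
  refine ((hasDerivAt_sqrt_one_add y).inv hr).congr_deriv ?_
  field_simp

theorem IsFrameField.hasDerivAt_wVec {F : ℝ → ℝ → Fin 4 → E4} (hF : IsFrameField F) {x : ℝ}
    (hx : 0 < x) (hq : 0 < X0q x) (y : ℝ) :
    HasDerivAt (wVec F x)
      (-(y ^ 2 / (1 + y ^ 2) * mC x y) • uVec F x y - (y / (1 + y ^ 2) * nC x y) • F x y 1
        + (y / (1 + y ^ 2) * kC x y) • F x y 3) y := by
  have hh := (h_pos hq y).ne'
  have hr := (sqrt_one_add_pos y).ne'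
  have hs := sq_sqrt_one_add y
  refine ((hasDerivAt_inv_sqrt_one_add y).smul ((hF.hasDerivAt_Xβ hx y).add
    ((hasDerivAt_id y).smul (hF.hasDerivAt_φ hx y)))).congr_deriv ?_
  simp only [uVec, id, a₂_eq hq, b₂_eq, c₂_eq, nC, kC, mC, Pi.add_apply, Pi.smul_apply']
  generalize √(1 + y ^ 2) = r at *
  rw [← hs]
  match_scalars <;> field_simp
  all_goals first | ring1 | linear_combination y * h x y * hs

theorem IsFrameField.hasDerivAt_uVec {F : ℝ → ℝ → Fin 4 → E4} (hF : IsFrameField F) {x : ℝ}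
    (hx : 0 < x) (hq : 0 < X0q x) (y : ℝ) :
    HasDerivAt (uVec F x) ((y ^ 2 / (1 + y ^ 2)) • vVec F x y) y := by
  have hh := (h_pos hq y).ne'
  have hr := (sqrt_one_add_pos y).ne'
  have hs := sq_sqrt_one_add y
  refine ((hasDerivAt_inv_sqrt_one_add y).smul (((hasDerivAt_id y).smul (hF.hasDerivAt_Xβ hx y)).sub
    (hF.hasDerivAt_φ hx y))).congr_deriv ?_
  simp only [vVec, wVec, id, a₂_eq hq, b₂_eq, c₂_eq, nC, kC, mC, Pi.sub_apply, Pi.smul_apply']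
  generalize √(1 + y ^ 2) = r at *
  rw [← hs]
  match_scalars <;> field_simp
  all_goals first | ring1 | linear_combination -y * h x y * hs

theorem IsFrameField.hasDerivAt_vVec {F : ℝ → ℝ → Fin 4 → E4} (hF : IsFrameField F) {x : ℝ}
    (hx : 0 < x) (hq : 0 < X0q x) (y : ℝ) :
    HasDerivAt (vVec F x) (-((y ^ 2 / (1 + y ^ 2)) • uVec F x y)) y := by
  refine ((((hasDerivAt_mC hq y).smul (hF.hasDerivAt_wVec hx hq y)).sub
    ((hasDerivAt_nC hq y).smul (hF.hasDerivAt_Xα_y hx hq y))).add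
    ((hasDerivAt_kC hq y).smul (hF.hasDerivAt_ξ_y hx hq y))).congr_deriv ?_
  match_scalars
  · linear_combination -(y ^ 2 / (1 + y ^ 2)) * m_sq_add hq y
  all_goals ring

theorem IsFrameField.hasDerivAt_bVec {F : ℝ → ℝ → Fin 4 → E4} (hF : IsFrameField F) {x : ℝ}
    (hx : 0 < x) (hq : 0 < X0q x) (y : ℝ) :
    HasDerivAt (bVec F x) ((y / (1 + y ^ 2) * nC x y) •
      (wVec F x y - mC x y • vVec F x y)) y := by
  refine ((hF.hasDerivAt_Xα_y hx hq y).add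
    ((hasDerivAt_nC hq y).smul (hF.hasDerivAt_vVec hx hq y))).congr_deriv ?_
  module

theorem IsFrameField.hasDerivAt_nVec {F : ℝ → ℝ → Fin 4 → E4} (hF : IsFrameField F) {x : ℝ}
    (hx : 0 < x) (hq : 0 < X0q x) (y : ℝ) :
    HasDerivAt (nVec F x) (-(y / (1 + y ^ 2) * nC x y) •
      (kC x y • F x y 1 + nC x y • F x y 3)) y := by
  refine (((hasDerivAt_kC hq y).smul (hF.hasDerivAt_wVec hx hq y)).sub
    ((hasDerivAt_mC hq y).smul (hF.hasDerivAt_ξ_y hx hq y))).congr_deriv ?_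
  match_scalars <;> ring

theorem norm_sub_le_of_norm_deriv_le {G G' : ℝ → E4} {H H' : ℝ → ℝ} {a b : ℝ} (hab : a ≤ b)
    (hG : ∀ t, a ≤ t → HasDerivAt G (G' t) t) (hH : ∀ t, HasDerivAt H (H' t) t)
    (hle : ∀ t, a ≤ t → ‖G' t‖ ≤ H' t) : ‖G b - G a‖ ≤ H b - H a := by
  refine image_norm_le_of_norm_deriv_right_le_deriv_boundary
    (f := fun t => G t - G a) (f' := G') (a := a) (b := b) (B := fun t => H t - H a) (B' := H')
    (fun t ht => ((hG t ht.1).sub_const _).continuousAt.continuousWithinAt)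
    (fun t ht => ((hG t ht.1).sub_const _).hasDerivWithinAt) (by simp)
    (fun t => (hH t).sub_const _) (fun t ht => hle t ht.1) ⟨hab, le_rfl⟩

theorem norm_sub_le_arctan {G G' : ℝ → E4} {C : ℝ} (hC : 0 ≤ C)
    (hG : ∀ y, HasDerivAt G (G' y) y) (hle : ∀ y, ‖G' y‖ ≤ C / (1 + y ^ 2)) (y : ℝ) :
    ‖G y - G 0‖ ≤ 2 * C := by
  have hH : ∀ t, HasDerivAt (fun t => C * Real.arctan t) (C / (1 + t ^ 2)) t := fun t =>
    ((Real.hasDerivAt_arctan t).const_mul C).congr_deriv (by ring)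
  have h1 := Real.arctan_lt_pi_div_two y
  have h2 := Real.neg_pi_div_two_lt_arctan y
  have h3 := Real.pi_lt_four
  rcases le_total 0 y with hy | hy
  · have := norm_sub_le_of_norm_deriv_le hy (fun t _ => hG t) hH (fun t _ => hle t)
    rw [Real.arctan_zero] at this
    nlinarith
  · have := norm_sub_le_of_norm_deriv_le hy (fun t _ => hG t) hH (fun t _ => hle t)
    rw [Real.arctan_zero] at this
    rw [norm_sub_rev]
    nlinarith

theorem IsFrameField.inner_eq {F : ℝ → ℝ → Fin 4 → E4} (hF : IsFrameField F) {x : ℝ}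
    (hx : 0 < x) (y : ℝ) (i j : Fin 4) :
    inner ℝ (F x y i) (F x y j) = if i = j then 1 else 0 :=
  orthonormal_iff_ite.1 (hF.orthonormal x y hx) i j

theorem IsFrameField.norm_eq {F : ℝ → ℝ → Fin 4 → E4} (hF : IsFrameField F) {x : ℝ}
    (hx : 0 < x) (y : ℝ) (i : Fin 4) : ‖F x y i‖ = 1 :=
  (hF.orthonormal x y hx).1 i

theorem IsFrameField.inner_u_u {F : ℝ → ℝ → Fin 4 → E4} (hF : IsFrameField F) {x : ℝ}
    (hx : 0 < x) (y : ℝ) : inner ℝ (uVec F x y) (uVec F x y) = 1 := by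
  have hr := (sqrt_one_add_pos y).ne'
  have hs := sq_sqrt_one_add y
  simp only [uVec, inner_sub_left, inner_sub_right, real_inner_smul_left, real_inner_smul_right,
    hF.inner_eq hx]
  simp
  field_simp
  linear_combination -hs

theorem IsFrameField.inner_w_w {F : ℝ → ℝ → Fin 4 → E4} (hF : IsFrameField F) {x : ℝ}
    (hx : 0 < x) (y : ℝ) : inner ℝ (wVec F x y) (wVec F x y) = 1 := by
  have hr := (sqrt_one_add_pos y).ne'
  have hs := sq_sqrt_one_add y
  simp only [wVec, inner_add_left, inner_add_right, real_inner_smul_left, real_inner_smul_right,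
    hF.inner_eq hx]
  simp
  field_simp
  linear_combination -hs

theorem IsFrameField.inner_w_u {F : ℝ → ℝ → Fin 4 → E4} (hF : IsFrameField F) {x : ℝ}
    (hx : 0 < x) (y : ℝ) : inner ℝ (wVec F x y) (uVec F x y) = 0 := by
  simp only [wVec, uVec, inner_add_left, inner_sub_right, real_inner_smul_left,
    real_inner_smul_right, hF.inner_eq hx]
  simp
  exact Or.inr (by ring)

theorem IsFrameField.inner_Xα_u {F : ℝ → ℝ → Fin 4 → E4} (hF : IsFrameField F) {x : ℝ}
    (hx : 0 < x) (y : ℝ) : inner ℝ (F x y 1) (uVec F x y) = 0 := by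
  simp only [uVec, inner_sub_right, real_inner_smul_right, hF.inner_eq hx]
  simp

theorem IsFrameField.inner_ξ_u {F : ℝ → ℝ → Fin 4 → E4} (hF : IsFrameField F) {x : ℝ}
    (hx : 0 < x) (y : ℝ) : inner ℝ (F x y 3) (uVec F x y) = 0 := by
  simp only [uVec, inner_sub_right, real_inner_smul_right, hF.inner_eq hx]
  simp

theorem IsFrameField.inner_Xα_w {F : ℝ → ℝ → Fin 4 → E4} (hF : IsFrameField F) {x : ℝ}
    (hx : 0 < x) (y : ℝ) : inner ℝ (F x y 1) (wVec F x y) = 0 := by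
  simp only [wVec, inner_add_right, real_inner_smul_right, hF.inner_eq hx]
  simp

theorem IsFrameField.inner_ξ_w {F : ℝ → ℝ → Fin 4 → E4} (hF : IsFrameField F) {x : ℝ}
    (hx : 0 < x) (y : ℝ) : inner ℝ (F x y 3) (wVec F x y) = 0 := by
  simp only [wVec, inner_add_right, real_inner_smul_right, hF.inner_eq hx]
  simp

theorem IsFrameField.inner_v_u {F : ℝ → ℝ → Fin 4 → E4} (hF : IsFrameField F) {x : ℝ}
    (hx : 0 < x) (y : ℝ) : inner ℝ (vVec F x y) (uVec F x y) = 0 := by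
  simp only [vVec, inner_add_left, inner_sub_left, real_inner_smul_left, hF.inner_w_u hx,
    hF.inner_Xα_u hx, hF.inner_ξ_u hx]
  simp

theorem IsFrameField.inner_v_v {F : ℝ → ℝ → Fin 4 → E4} (hF : IsFrameField F) {x : ℝ}
    (hx : 0 < x) (hq : 0 < X0q x) (y : ℝ) : inner ℝ (vVec F x y) (vVec F x y) = 1 := by
  have h1 := hF.inner_Xα_w hx y
  have h3 := hF.inner_ξ_w hx y
  simp only [vVec, inner_add_left, inner_sub_left, real_inner_smul_left, inner_add_right,
    inner_sub_right, real_inner_smul_right, h1, h3, real_inner_comm (F x y 1) (wVec F x y),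
    real_inner_comm (F x y 3) (wVec F x y), hF.inner_w_w hx, hF.inner_eq hx]
  simp
  linear_combination m_sq_add hq y

theorem norm_eq_one_of_inner {v : E4} (hv : inner ℝ v v = (1 : ℝ)) : ‖v‖ = 1 := by
  rw [real_inner_self_eq_norm_sq] at hv
  exact (pow_eq_one_iff_of_nonneg (norm_nonneg v) two_ne_zero).1 hv

theorem mC_abs_le {x : ℝ} (hq : 0 < X0q x) (y : ℝ) : |mC x y| ≤ 1 := by
  rw [← sq_le_one_iff_abs_le_one]
  nlinarith [m_sq_add hq y, sq_nonneg (nC x y), sq_nonneg (kC x y)]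

theorem nC_abs_le {x : ℝ} (hq : 0 < X0q x) (y : ℝ) : |nC x y| ≤ 1 := by
  rw [← sq_le_one_iff_abs_le_one]
  nlinarith [m_sq_add hq y, sq_nonneg (mC x y), sq_nonneg (kC x y)]

theorem kC_abs_le {x : ℝ} (hq : 0 < X0q x) (y : ℝ) : |kC x y| ≤ 1 := by
  rw [← sq_le_one_iff_abs_le_one]
  nlinarith [m_sq_add hq y, sq_nonneg (nC x y), sq_nonneg (mC x y)]

/-- The values of `x` near `0` that satisfy the bounds used in all estimates. -/
structure IsSmall (x : ℝ) : Prop where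
  pos : 0 < x
  one_le : 1 ≤ X0q x
  le_three : X0q x ≤ 3
  abs_le : |X0p x| ≤ 1

theorem IsSmall.q_pos {x : ℝ} (hx : IsSmall x) : 0 < X0q x := lt_of_lt_of_le one_pos hx.one_le

theorem IsSmall.le_h {x : ℝ} (hx : IsSmall x) (y : ℝ) : 1 + y ^ 2 ≤ h x y :=
  le_trans (by nlinarith [hx.one_le, sq_nonneg y]) (CurvSurf.le_h hx.q_pos y)

theorem sqrt_div_h_le {x : ℝ} (hx : IsSmall x) (y : ℝ) :
    √(1 + y ^ 2) / h x y ≤ 1 / √(1 + y ^ 2) := by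
  have hr := sqrt_one_add_pos y
  rw [div_le_div_iff₀ (h_pos hx.q_pos y) hr, one_mul, ← sq, sq_sqrt_one_add]
  exact hx.le_h y

theorem nC_abs_le_div {x : ℝ} (hx : IsSmall x) (y : ℝ) :
    |nC x y| ≤ 2 * |X0p x| / √(1 + y ^ 2) := by
  have hh := h_pos hx.q_pos y
  rw [nC, abs_div, abs_mul, abs_mul, abs_of_pos hh, abs_of_pos (sqrt_one_add_pos y), abs_two]
  calc 2 * |X0p x| * √(1 + y ^ 2) / h x y = 2 * |X0p x| * (√(1 + y ^ 2) / h x y) := by ring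
    _ ≤ 2 * |X0p x| * (1 / √(1 + y ^ 2)) :=
      mul_le_mul_of_nonneg_left (sqrt_div_h_le hx y) (by positivity)
    _ = _ := by ring

theorem nC_abs_le_two_mul {x : ℝ} (hx : IsSmall x) (y : ℝ) : |nC x y| ≤ 2 * |X0p x| := by
  refine (nC_abs_le_div hx y).trans (div_le_self (by positivity) ?_)
  rw [Real.one_le_sqrt]
  nlinarith [sq_nonneg y]

theorem sqrt_five_lt : √5 < 5 / 2 := by
  rw [Real.sqrt_lt' (by norm_num)]; norm_num

theorem lt_sqrt_five : 2 < √5 := by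
  rw [Real.lt_sqrt (by norm_num)]; norm_num

theorem kC_abs_le_div {x : ℝ} (hx : IsSmall x) (y : ℝ) :
    |kC x y| ≤ 8 / √(1 + y ^ 2) := by
  have hh := h_pos hx.q_pos y
  have hq := hx.q_pos
  have h5 := sqrt_five_lt
  have h3 := hx.le_three
  rw [kC, abs_of_pos (by positivity)]
  calc (X0q x + 2 * √5) * √(1 + y ^ 2) / h x y = (X0q x + 2 * √5) * (√(1 + y ^ 2) / h x y) := by
        ring
    _ ≤ 8 * (1 / √(1 + y ^ 2)) :=
      mul_le_mul (by linarith) (sqrt_div_h_le hx y)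
        (div_nonneg (sqrt_one_add_pos y).le hh.le) (by norm_num)
    _ = _ := by ring

theorem norm_smul_le_of_bound {x : ℝ} (hx : IsSmall x) (y : ℝ) {v : E4}
    (hv : ‖v‖ ≤ 2 * (|nC x y| + |kC x y|)) :
    ‖(y / (1 + y ^ 2) * nC x y) • v‖ ≤ 40 * |X0p x| / (1 + y ^ 2) := by
  have hr := sqrt_one_add_pos y
  have hs := sq_sqrt_one_add y
  have h1 : |y / (1 + y ^ 2)| ≤ 1 := by
    rw [abs_div, abs_of_pos (by positivity : 0 < 1 + y ^ 2), div_le_one (by positivity)]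
    nlinarith [sq_nonneg (|y| - 1), sq_abs y, abs_nonneg y]
  have h2 : |nC x y| ≤ 2 / √(1 + y ^ 2) := by
    refine (nC_abs_le_div hx y).trans ?_
    gcongr
    linarith [hx.abs_le]
  have h3 : ‖v‖ ≤ 20 / √(1 + y ^ 2) := by
    calc ‖v‖ ≤ 2 * (|nC x y| + |kC x y|) := hv
      _ ≤ 2 * (2 / √(1 + y ^ 2) + 8 / √(1 + y ^ 2)) := by
        gcongr
        exact kC_abs_le_div hx y
      _ = _ := by ring
  rw [norm_smul, Real.norm_eq_abs, abs_mul]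
  calc |y / (1 + y ^ 2)| * |nC x y| * ‖v‖
      ≤ 1 * (2 * |X0p x| / √(1 + y ^ 2)) * (20 / √(1 + y ^ 2)) := by
        gcongr
        exact nC_abs_le_div hx y
    _ = 40 * |X0p x| / √(1 + y ^ 2) ^ 2 := by ring
    _ = _ := by rw [hs]

theorem norm_smul_unit {a : ℝ} {v : E4} (hv : ‖v‖ = 1) : ‖a • v‖ = |a| := by
  rw [norm_smul, hv, mul_one, Real.norm_eq_abs]

theorem IsFrameField.bVec_sub_le {F : ℝ → ℝ → Fin 4 → E4} (hF : IsFrameField F) {x : ℝ}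
    (hx : IsSmall x) (y : ℝ) : ‖bVec F x y - bVec F x 0‖ ≤ 2 * (40 * |X0p x|) := by
  refine norm_sub_le_arctan (by positivity) (hF.hasDerivAt_bVec hx.pos hx.q_pos) (fun y => ?_) y
  refine norm_smul_le_of_bound hx y ?_
  have e : wVec F x y - mC x y • vVec F x y
      = nC x y • (nC x y • wVec F x y + mC x y • F x y 1)
        + kC x y • (kC x y • wVec F x y - mC x y • F x y 3) := by
    rw [vVec]
    match_scalars
    · linear_combination -m_sq_add hx.q_pos y
    all_goals ring
  have hm := mC_abs_le hx.q_pos y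
  have hn := nC_abs_le hx.q_pos y
  have hk := kC_abs_le hx.q_pos y
  have hw := norm_eq_one_of_inner (hF.inner_w_w hx.pos y)
  have h1 : ‖nC x y • wVec F x y + mC x y • F x y 1‖ ≤ 2 := by
    refine (norm_add_le _ _).trans ?_
    rw [norm_smul_unit hw, norm_smul_unit (hF.norm_eq hx.pos y 1)]
    linarith
  have h2 : ‖kC x y • wVec F x y - mC x y • F x y 3‖ ≤ 2 := by
    refine (norm_sub_le _ _).trans ?_
    rw [norm_smul_unit hw, norm_smul_unit (hF.norm_eq hx.pos y 3)]
    linarith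
  rw [e]
  refine (norm_add_le _ _).trans ?_
  rw [norm_smul, norm_smul, Real.norm_eq_abs, Real.norm_eq_abs]
  nlinarith [abs_nonneg (nC x y), abs_nonneg (kC x y)]

theorem IsFrameField.nVec_sub_le {F : ℝ → ℝ → Fin 4 → E4} (hF : IsFrameField F) {x : ℝ}
    (hx : IsSmall x) (y : ℝ) : ‖nVec F x y - nVec F x 0‖ ≤ 2 * (40 * |X0p x|) := by
  refine norm_sub_le_arctan (by positivity) (hF.hasDerivAt_nVec hx.pos hx.q_pos) (fun y => ?_) y
  rw [neg_smul, norm_neg]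
  refine norm_smul_le_of_bound hx y ((norm_add_le _ _).trans ?_)
  rw [norm_smul_unit (hF.norm_eq hx.pos y 1), norm_smul_unit (hF.norm_eq hx.pos y 3)]
  linarith [abs_nonneg (nC x y), abs_nonneg (kC x y)]

theorem IsFrameField.hasDerivAt_x {F : ℝ → ℝ → Fin 4 → E4} (hF : IsFrameField F) {x : ℝ}
    (hx : 0 < x) (y : ℝ) :
    HasDerivAt (fun s => F s y 0) (-(a₁ x y • F x y 1)) x ∧
    HasDerivAt (fun s => F s y 1)
      (a₁ x y • F x y 0 - c₁ x y • F x y 2 - b₁ x y • F x y 3) x ∧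
    HasDerivAt (fun s => F s y 2) (c₁ x y • F x y 1) x ∧
    HasDerivAt (fun s => F s y 3) (b₁ x y • F x y 1) x := by
  refine ⟨(hF.deriv_x x y hx 0).congr_deriv ?_, (hF.deriv_x x y hx 1).congr_deriv ?_,
    (hF.deriv_x x y hx 2).congr_deriv ?_, (hF.deriv_x x y hx 3).congr_deriv ?_⟩ <;>
  simp [Fin.sum_univ_four, Ω₁]
  abel

theorem eq_of_hasDerivAt_zero {G : ℝ → E4} (hG : ∀ x, 0 < x → HasDerivAt G 0 x) {x x' : ℝ}
    (hx : 0 < x) (hx' : 0 < x') : G x = G x' :=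
  isOpen_Ioi.is_const_of_deriv_eq_zero (s := Ioi 0) (convex_Ioi 0).isPreconnected
    (fun x hx => (hG x hx).differentiableAt.differentiableWithinAt)
    (fun x hx => (hG x hx).deriv) hx hx'

theorem IsFrameField.uVec_eq {F : ℝ → ℝ → Fin 4 → E4} (hF : IsFrameField F) {x x' : ℝ}
    (hx : 0 < x) (hx' : 0 < x') (y : ℝ) : uVec F x y = uVec F x' y := by
  refine eq_of_hasDerivAt_zero (G := fun x => uVec F x y) (fun x hx => ?_) hx hx'
  obtain ⟨d0, -, d2, -⟩ := hF.hasDerivAt_x hx y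
  refine (((d2.const_smul y).sub d0).const_smul (√(1 + y ^ 2))⁻¹).congr_deriv ?_
  have : a₁ x y = -(y * c₁ x y) := by rw [a₁, c₁]; ring
  rw [this]
  module

/-- In terms of `wVec` and `ξ`, `fVec` is `(w - 2 √(1 + y²) ξ) / √(5 + 4 y²)`. -/
theorem fVec_eq (F : ℝ → ℝ → Fin 4 → E4) (x y : ℝ) :
    fVec F x y = (√(5 + 4 * y ^ 2))⁻¹ • (wVec F x y - (2 * √(1 + y ^ 2)) • F x y 3) := by
  have hr := (sqrt_one_add_pos y).ne'
  have hR : √(5 + 4 * y ^ 2) ≠ 0 := (Real.sqrt_pos.2 (by positivity)).ne'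
  have hs := sq_sqrt_one_add y
  rw [fVec, wVec, Real.sqrt_mul (by positivity)]
  generalize √(1 + y ^ 2) = r at *
  rw [← hs]
  match_scalars <;> field_simp

theorem sq_sqrt_five_add (y : ℝ) : √(5 + 4 * y ^ 2) ^ 2 = 5 + 4 * y ^ 2 :=
  Real.sq_sqrt (by positivity)

theorem sqrt_five_add_pos (y : ℝ) : 0 < √(5 + 4 * y ^ 2) := Real.sqrt_pos.2 (by positivity)

theorem IsFrameField.inner_f_f {F : ℝ → ℝ → Fin 4 → E4} (hF : IsFrameField F) {x : ℝ}
    (hx : 0 < x) (y : ℝ) : inner ℝ (fVec F x y) (fVec F x y) = 1 := by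
  have hR := (sqrt_five_add_pos y).ne'
  have hS := sq_sqrt_five_add y
  have hs := sq_sqrt_one_add y
  have h3 := hF.inner_ξ_w hx y
  simp only [fVec_eq, inner_sub_left, inner_sub_right, real_inner_smul_left,
    real_inner_smul_right, hF.inner_w_w hx, h3, real_inner_comm (F x y 3) (wVec F x y),
    hF.inner_eq hx]
  simp
  field_simp
  linear_combination 4 * hs - hS

theorem IsFrameField.inner_f_u {F : ℝ → ℝ → Fin 4 → E4} (hF : IsFrameField F) {x : ℝ}
    (hx : 0 < x) (y : ℝ) : inner ℝ (fVec F x y) (uVec F x y) = 0 := by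
  simp only [fVec_eq, inner_sub_left, real_inner_smul_left, hF.inner_w_u hx, hF.inner_ξ_u hx]
  simp

theorem radS_eq (y : ℝ) : radS y = √(5 + 4 * y ^ 2) / (2 * √5 * √(1 + y ^ 2)) := by
  rw [radS, Real.sqrt_div (by positivity)]
  ring

theorem radS_mul_inv (y : ℝ) :
    radS y * (√((1 + y ^ 2) * (5 + 4 * y ^ 2)))⁻¹ * (1 + y ^ 2) * (2 * √5) = 1 := by
  have hr := (sqrt_one_add_pos y).ne'
  have hR := (sqrt_five_add_pos y).ne'
  have h5 : √5 ≠ 0 := by positivity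
  have hs := sq_sqrt_one_add y
  rw [radS_eq, Real.sqrt_mul (by positivity)]
  generalize √(1 + y ^ 2) = r at *
  rw [← hs]
  field_simp

theorem IsFrameField.hasDerivAt_fVec_x {F : ℝ → ℝ → Fin 4 → E4} (hF : IsFrameField F) {x : ℝ}
    (hx : 0 < x) (y : ℝ) : HasDerivAt (fun s => fVec F s y)
      (((√((1 + y ^ 2) * (5 + 4 * y ^ 2)))⁻¹ * ((1 + y ^ 2) *
        (2 * √5 * ((x ^ 2 - y ^ 2) / (x * h x y))))) • F x y 1) x := by
  obtain ⟨d0, -, d2, d3⟩ := hF.hasDerivAt_x hx y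
  have e1 : (1 + y ^ 2) * (2 * √5 * ((x ^ 2 - y ^ 2) / (x * h x y)))
      = c₁ x y - 2 * (1 + y ^ 2) * b₁ x y - y * a₁ x y := by
    rw [a₁, b₁, c₁]; ring
  rw [e1]
  simp only [fVec]
  generalize (√((1 + y ^ 2) * (5 + 4 * y ^ 2)))⁻¹ = S
  generalize 2 * (1 + y ^ 2) = T
  refine (((d2.sub (d3.const_smul T)).add (d0.const_smul y)).const_smul S).congr_deriv ?_
  module

theorem IsCurvatureSurface.center_eq {F : ℝ → ℝ → Fin 4 → E4} {f : ℝ → ℝ → E4}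
    (hf : IsCurvatureSurface F f) {x x' : ℝ} (hx : 0 < x) (hx' : 0 < x') (y : ℝ) :
    f x y - radS y • fVec F x y = f x' y - radS y • fVec F x' y := by
  refine eq_of_hasDerivAt_zero (G := fun x => f x y - radS y • fVec F x y)
    (fun x hx => ?_) hx hx'
  refine ((hf.deriv_x x y hx).sub ((hf.frame.hasDerivAt_fVec_x hx y).const_smul
    (radS y))).congr_deriv ?_
  rw [smul_smul, ← sub_smul]
  convert zero_smul ℝ (F x y 1) using 2
  linear_combination -((x ^ 2 - y ^ 2) / (x * h x y)) * radS_mul_inv y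

theorem IsFrameField.continuous_vVec {F : ℝ → ℝ → Fin 4 → E4} (hF : IsFrameField F) {x : ℝ}
    (hx : 0 < x) (hq : 0 < X0q x) : Continuous (vVec F x) :=
  continuous_iff_continuousAt.2 fun y => (hF.hasDerivAt_vVec hx hq y).continuousAt

theorem IsFrameField.vVec_eq {F : ℝ → ℝ → Fin 4 → E4} (hF : IsFrameField F) {x x' : ℝ}
    (hx : 0 < x) (hx' : 0 < x') (hq : 0 < X0q x) (hq' : 0 < X0q x') (y : ℝ) :
    vVec F x y = vVec F x' y := by
  have key : EqOn (vVec F x) (vVec F x') {0}ᶜ := by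
    intro y hy
    have h1 := hF.hasDerivAt_uVec hx hq y
    rw [show uVec F x = uVec F x' from funext fun y => hF.uVec_eq hx hx' y] at h1
    have h2 := h1.unique (hF.hasDerivAt_uVec hx' hq' y)
    have hy' : y ≠ 0 := hy
    exact smul_right_injective _ (by positivity : y ^ 2 / (1 + y ^ 2) ≠ 0) h2
  exact congrFun ((hF.continuous_vVec hx hq).ext_on (dense_compl_singleton 0)
    (hF.continuous_vVec hx' hq') key) y

theorem exists_tendsto_of_norm_deriv_le {G G' : ℝ → E4} {T C : ℝ}
    (hG : ∀ t, T ≤ t → HasDerivAt G (G' t) t)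
    (hle : ∀ t, T ≤ t → ‖G' t‖ ≤ C * Real.exp (-(2 * t))) :
    ∃ l, Tendsto G atTop (𝓝 l) := by
  have hC : 0 ≤ C := by
    have := (norm_nonneg _).trans (hle T le_rfl)
    exact nonneg_of_mul_nonneg_left this (Real.exp_pos _)
  have hH : ∀ t : ℝ, HasDerivAt (fun t : ℝ => -(C / 2) * Real.exp (-(2 * t)))
      (C * Real.exp (-(2 * t))) t := by
    intro t
    have h1 : HasDerivAt (fun t : ℝ => -(2 * t)) (-2) t :=
      (((hasDerivAt_id t).const_mul 2).neg).congr_deriv (by simp)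
    exact (h1.exp.const_mul _).congr_deriv (by ring)
  have h0 : Tendsto (fun t : ℝ => C / 2 * Real.exp (-(2 * t))) atTop (𝓝 0) := by
    have : Tendsto (fun t : ℝ => -(2 * t)) atTop atBot :=
      tendsto_neg_atTop_atBot.comp (tendsto_id.const_mul_atTop two_pos)
    simpa using (Real.tendsto_exp_atBot.comp this).const_mul (C / 2)
  refine cauchySeq_tendsto_of_complete (Metric.cauchySeq_iff'.2 fun ε hε => ?_)
  obtain ⟨N, hN, hNT⟩ := ((h0.eventually_lt_const hε).and (eventually_ge_atTop T)).exists
  refine ⟨N, fun n hn => ?_⟩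
  have := norm_sub_le_of_norm_deriv_le (G := G) hn (fun t ht => hG t (hNT.trans ht)) hH
    (fun t ht => hle t (hNT.trans ht))
  rw [dist_eq_norm]
  nlinarith [mul_nonneg hC (Real.exp_pos (-(2 * n))).le]

theorem tendsto_exp_neg : Tendsto (fun t : ℝ => Real.exp (-t)) atTop (𝓝 0) :=
  Real.tendsto_exp_neg_atTop_nhds_zero

theorem tendsto_X0q : Tendsto (fun t : ℝ => X0q (Real.exp (-t))) atTop (𝓝 2) := by
  have := (continuous_X0q.tendsto 0).comp tendsto_exp_neg
  rwa [X0q_zero] at this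

theorem tendsto_X0p : Tendsto (fun t : ℝ => X0p (Real.exp (-t))) atTop (𝓝 0) := by
  have := (continuous_X0p.tendsto 0).comp tendsto_exp_neg
  rwa [X0p_zero] at this

theorem tendsto_abs_X0p : Tendsto (fun t : ℝ => |X0p (Real.exp (-t))|) atTop (𝓝 0) := by
  simpa using tendsto_X0p.abs

theorem eventually_isSmall : ∀ᶠ t : ℝ in atTop, IsSmall (Real.exp (-t)) := by
  filter_upwards [tendsto_X0q.eventually_le_const (by norm_num : (2 : ℝ) < 3),
    tendsto_X0q.eventually_const_le (by norm_num : (1 : ℝ) < 2),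
    tendsto_abs_X0p.eventually_le_const one_pos] with t h1 h2 h3
  exact ⟨Real.exp_pos _, h2, h1, h3⟩

/-- The unit vector `-(2 X_β + ξ) / √5` on the curve `y = 0`. -/
def zVec (F : ℝ → ℝ → Fin 4 → E4) (x : ℝ) : E4 := -((√5)⁻¹ • ((2 : ℝ) • F x 0 2 + F x 0 3))

theorem IsFrameField.inner_z_z {F : ℝ → ℝ → Fin 4 → E4} (hF : IsFrameField F) {x : ℝ}
    (hx : 0 < x) : inner ℝ (zVec F x) (zVec F x) = 1 := by
  have h5 : √5 ≠ 0 := by positivity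
  have hs := sqrt_five_sq
  simp only [zVec, inner_add_left, inner_add_right, real_inner_smul_left, real_inner_smul_right,
    hF.inner_eq hx, inner_neg_left, inner_neg_right]
  simp
  field_simp
  linear_combination -hs

theorem IsFrameField.inner_Xα_z {F : ℝ → ℝ → Fin 4 → E4} (hF : IsFrameField F) {x : ℝ}
    (hx : 0 < x) : inner ℝ (F x 0 1) (zVec F x) = 0 := by
  simp only [zVec, inner_add_right, real_inner_smul_right, hF.inner_eq hx, inner_neg_right]
  simp

/-- The deviation of `x c₁(x, 0)` from its limit. -/
def cErr (x : ℝ) : ℝ := -(x ^ 2 * X0q x / h x 0)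

/-- The deviation of `x b₁(x, 0)` from its limit. -/
def bErr (x : ℝ) : ℝ := -(x ^ 2 * (X0q x / 2 + √5) / h x 0)

theorem mul_c₁ {x : ℝ} (hx : IsSmall x) : x * c₁ x 0 = -1 + cErr x := by
  have hh := (h_pos hx.q_pos 0).ne'
  have h0 := hx.pos.ne'
  rw [c₁, cErr]
  field_simp
  rw [h_eq]
  ring

theorem mul_b₁ {x : ℝ} (hx : IsSmall x) : x * b₁ x 0 = -(1 / 2) + bErr x := by
  have hh := (h_pos hx.q_pos 0).ne'
  have h0 := hx.pos.ne'
  rw [b₁, bErr]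
  field_simp
  rw [h_eq]
  ring

theorem abs_cErr_le {x : ℝ} (hx : IsSmall x) : |cErr x| ≤ x ^ 2 := by
  have hh := h_pos hx.q_pos 0
  have h1 := le_h hx.q_pos 0
  have hq := hx.q_pos
  rw [cErr, abs_neg, abs_of_nonneg (by positivity), div_le_iff₀ hh]
  have : X0q x ≤ h x 0 := by linarith
  gcongr

theorem abs_bErr_le {x : ℝ} (hx : IsSmall x) : |bErr x| ≤ 3 * x ^ 2 := by
  have hh := h_pos hx.q_pos 0
  have h1 := le_h hx.q_pos 0
  have hq := hx.q_pos
  rw [bErr, abs_neg, abs_of_nonneg (by positivity), div_le_iff₀ hh]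
  have : X0q x / 2 + √5 ≤ 3 * h x 0 := by linarith [sqrt_five_lt, hx.one_le]
  nlinarith [mul_le_mul_of_nonneg_left this (sq_nonneg x)]

theorem hasDerivAt_exp_neg (t : ℝ) :
    HasDerivAt (fun t : ℝ => Real.exp (-t)) (-Real.exp (-t)) t :=
  ((hasDerivAt_neg t).exp).congr_deriv (by ring)

theorem IsFrameField.hasDerivAt_Xα_exp {F : ℝ → ℝ → Fin 4 → E4} (hF : IsFrameField F) {t : ℝ}
    (ht : IsSmall (Real.exp (-t))) :
    HasDerivAt (fun t => F (Real.exp (-t)) 0 1)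
      ((√5 / 2) • zVec F (Real.exp (-t)) + (cErr (Real.exp (-t)) • F (Real.exp (-t)) 0 2
        + bErr (Real.exp (-t)) • F (Real.exp (-t)) 0 3)) t := by
  obtain ⟨-, d1, -, -⟩ := hF.hasDerivAt_x ht.pos 0
  refine (d1.scomp t (hasDerivAt_exp_neg t)).congr_deriv ?_
  have e0 : a₁ (Real.exp (-t)) 0 = 0 := by simp [a₁]
  have e1 := mul_c₁ ht
  have e2 := mul_b₁ ht
  have h5 : √5 ≠ 0 := by positivity
  rw [e0, zVec]
  generalize Real.exp (-t) = x at *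
  match_scalars
  · ring
  · field_simp
    linear_combination e1
  · field_simp
    linear_combination 2 * e2

theorem IsFrameField.hasDerivAt_z_exp {F : ℝ → ℝ → Fin 4 → E4} (hF : IsFrameField F) {t : ℝ}
    (ht : IsSmall (Real.exp (-t))) :
    HasDerivAt (fun t => zVec F (Real.exp (-t)))
      (-((√5 / 2) • F (Real.exp (-t)) 0 1)
        + ((√5)⁻¹ * (2 * cErr (Real.exp (-t)) + bErr (Real.exp (-t)))) •
          F (Real.exp (-t)) 0 1) t := by
  obtain ⟨-, -, d2, d3⟩ := hF.hasDerivAt_x ht.pos 0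
  have d : HasDerivAt (fun x => zVec F x) (-((√5)⁻¹ • ((2 : ℝ) • c₁ (Real.exp (-t)) 0 •
      F (Real.exp (-t)) 0 1 + b₁ (Real.exp (-t)) 0 • F (Real.exp (-t)) 0 1))) (Real.exp (-t)) := by
    simp only [zVec]
    exact (((d2.const_smul (2 : ℝ)).add d3).const_smul (√5)⁻¹).neg
  refine (HasDerivAt.scomp t d (hasDerivAt_exp_neg t)).congr_deriv ?_
  have e1 := mul_c₁ ht
  have e2 := mul_b₁ ht
  have h5 : √5 ≠ 0 := by positivity
  have hs := sqrt_five_sq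
  generalize Real.exp (-t) = x at *
  match_scalars
  field_simp
  linear_combination 4 * e1 + 2 * e2 + hs

theorem exists_limit_circle {F : ℝ → ℝ → Fin 4 → E4} (hF : IsFrameField F) :
    ∃ b c : E4, Tendsto (fun t => F (Real.exp (-t)) 0 1 - bCirc b c t) atTop (𝓝 0) ∧
      Tendsto (fun t => zVec F (Real.exp (-t)) - v2Circ b c t) atTop (𝓝 0) ∧
      ‖b‖ = 1 ∧ ‖c‖ = 1 ∧ inner ℝ b c = (0 : ℝ) ∧
      ∀ z : E4, Tendsto (fun t => inner ℝ (F (Real.exp (-t)) 0 1) z) atTop (𝓝 (0 : ℝ)) →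
        Tendsto (fun t => inner ℝ (zVec F (Real.exp (-t))) z) atTop (𝓝 (0 : ℝ)) →
        inner ℝ b z = (0 : ℝ) ∧ inner ℝ c z = (0 : ℝ) := by
  obtain ⟨T, hT⟩ := eventually_atTop.1 eventually_isSmall
  set X : ℝ → E4 := fun t => F (Real.exp (-t)) 0 1 with hX
  set Z : ℝ → E4 := fun t => zVec F (Real.exp (-t)) with hZ
  set C : ℝ → ℝ := fun t => Real.cos (√5 * t / 2) with hC
  set S : ℝ → ℝ := fun t => Real.sin (√5 * t / 2) with hS
  have hCS : ∀ t, C t ^ 2 + S t ^ 2 = 1 := fun t => Real.cos_sq_add_sin_sq _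
  have hC1 : ∀ t, |C t| ≤ 1 := fun t => Real.abs_cos_le_one _
  have hS1 : ∀ t, |S t| ≤ 1 := fun t => Real.abs_sin_le_one _
  have hθ : ∀ t : ℝ, HasDerivAt (fun t : ℝ => √5 * t / 2) (√5 / 2) t := fun t =>
    (((hasDerivAt_id t).const_mul (√5)).div_const 2).congr_deriv (by simp)
  have hC' : ∀ t, HasDerivAt C (-S t * (√5 / 2)) t := fun t => (hθ t).cos
  have hS' : ∀ t, HasDerivAt S (C t * (√5 / 2)) t := fun t => (hθ t).sin
  set P : ℝ → E4 := fun t => cErr (Real.exp (-t)) • F (Real.exp (-t)) 0 2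
        + bErr (Real.exp (-t)) • F (Real.exp (-t)) 0 3 with hP
  set Q : ℝ → E4 := fun t => ((√5)⁻¹ * (2 * cErr (Real.exp (-t)) + bErr (Real.exp (-t)))) •
          F (Real.exp (-t)) 0 1 with hQ
  have hX' : ∀ t, T ≤ t → HasDerivAt X ((√5 / 2) • Z t + P t) t := fun t ht =>
    hF.hasDerivAt_Xα_exp (hT t ht)
  have hZ' : ∀ t, T ≤ t → HasDerivAt Z (-((√5 / 2) • X t) + Q t) t := fun t ht =>
    hF.hasDerivAt_z_exp (hT t ht)
  have hPQ : ∀ t, T ≤ t → ‖P t‖ + ‖Q t‖ ≤ 9 * Real.exp (-(2 * t)) := by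
    intro t ht
    have h1 := abs_cErr_le (hT t ht)
    have h2 := abs_bErr_le (hT t ht)
    have e : Real.exp (-t) ^ 2 = Real.exp (-(2 * t)) := by
      rw [← Real.exp_nat_mul]; congr 1; push_cast; ring
    rw [← e]
    have p : ‖P t‖ ≤ |cErr (Real.exp (-t))| + |bErr (Real.exp (-t))| := by
      refine (norm_add_le _ _).trans ?_
      rw [norm_smul_unit (hF.norm_eq (Real.exp_pos _) _ _),
        norm_smul_unit (hF.norm_eq (Real.exp_pos _) _ _)]
    have q : ‖Q t‖ ≤ 2 * |cErr (Real.exp (-t))| + |bErr (Real.exp (-t))| := by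
      rw [hQ]
      simp only
      rw [norm_smul_unit (hF.norm_eq (Real.exp_pos _) _ _), abs_mul, abs_inv,
        abs_of_pos (by positivity : (0 : ℝ) < √5)]
      have i1 : (√5)⁻¹ ≤ 1 := inv_le_one_of_one_le₀ (by linarith [lt_sqrt_five])
      calc (√5)⁻¹ * |2 * cErr (Real.exp (-t)) + bErr (Real.exp (-t))|
          ≤ 1 * |2 * cErr (Real.exp (-t)) + bErr (Real.exp (-t))| := by gcongr
        _ ≤ |2 * cErr (Real.exp (-t))| + |bErr (Real.exp (-t))| := by
          rw [one_mul]; exact abs_add_le _ _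
        _ = _ := by rw [abs_mul, abs_two]
    linarith
  have bound : ∀ (t a b : ℝ), |a| ≤ 1 → |b| ≤ 1 → T ≤ t →
      ‖a • P t + b • Q t‖ ≤ 9 * Real.exp (-(2 * t)) := by
    intro t a b ha hb ht
    refine ((norm_add_le _ _).trans ?_).trans (hPQ t ht)
    rw [norm_smul, norm_smul, Real.norm_eq_abs, Real.norm_eq_abs]
    exact add_le_add (mul_le_of_le_one_left (norm_nonneg _) ha)
      (mul_le_of_le_one_left (norm_nonneg _) hb)
  obtain ⟨b, hb⟩ : ∃ l, Tendsto (fun t => C t • X t - S t • Z t) atTop (𝓝 l) := by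
    refine exists_tendsto_of_norm_deriv_le (T := T) (C := 9)
      (G' := fun t => C t • P t + (-S t) • Q t) (fun t ht => ?_)
      (fun t ht => bound t _ _ (hC1 t) (by rw [abs_neg]; exact hS1 t) ht)
    refine (((hC' t).smul (hX' t ht)).sub ((hS' t).smul (hZ' t ht))).congr_deriv ?_
    module
  obtain ⟨c, hc⟩ : ∃ l, Tendsto (fun t => S t • X t + C t • Z t) atTop (𝓝 l) := by
    refine exists_tendsto_of_norm_deriv_le (T := T) (C := 9)
      (G' := fun t => S t • P t + C t • Q t) (fun t ht => ?_)
      (fun t ht => bound t _ _ (hS1 t) (hC1 t) ht)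
    refine (((hS' t).smul (hX' t ht)).add ((hC' t).smul (hZ' t ht))).congr_deriv ?_
    module
  have iXX : ∀ t, inner ℝ (X t) (X t) = (1 : ℝ) := fun t => by
    simpa using hF.inner_eq (Real.exp_pos (-t)) 0 1 1
  have iZZ : ∀ t, inner ℝ (Z t) (Z t) = (1 : ℝ) := fun t => hF.inner_z_z (Real.exp_pos (-t))
  have iXZ : ∀ t, inner ℝ (X t) (Z t) = (0 : ℝ) := fun t => hF.inner_Xα_z (Real.exp_pos (-t))
  have iZX : ∀ t, inner ℝ (Z t) (X t) = (0 : ℝ) := fun t => by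
    rw [real_inner_comm]; exact iXZ t
  have hbb : inner ℝ b b = (1 : ℝ) := by
    refine tendsto_nhds_unique (hb.inner hb) (tendsto_const_nhds.congr fun t => ?_)
    simp only [inner_sub_left, inner_sub_right, real_inner_smul_left, real_inner_smul_right,
      iXX, iZZ, iXZ, iZX]
    linear_combination -hCS t
  have hcc : inner ℝ c c = (1 : ℝ) := by
    refine tendsto_nhds_unique (hc.inner hc) (tendsto_const_nhds.congr fun t => ?_)
    simp only [inner_add_left, inner_add_right, real_inner_smul_left, real_inner_smul_right,
      iXX, iZZ, iXZ, iZX]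
    linear_combination -hCS t
  have hbc : inner ℝ b c = (0 : ℝ) := by
    refine tendsto_nhds_unique (hb.inner hc) (tendsto_const_nhds.congr fun t => ?_)
    simp only [inner_sub_left, inner_add_right, real_inner_smul_left, real_inner_smul_right,
      iXX, iZZ, iXZ, iZX]
    ring
  have hb0 : Tendsto (fun t => ‖(C t • X t - S t • Z t) - b‖) atTop (𝓝 0) :=
    tendsto_iff_norm_sub_tendsto_zero.1 hb
  have hc0 : Tendsto (fun t => ‖(S t • X t + C t • Z t) - c‖) atTop (𝓝 0) :=
    tendsto_iff_norm_sub_tendsto_zero.1 hc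
  have hbc0 := hb0.add hc0
  rw [add_zero] at hbc0
  have small : ∀ (a d : ℝ) (v w : E4), |a| ≤ 1 → |d| ≤ 1 → ‖a • v + d • w‖ ≤ ‖v‖ + ‖w‖ := by
    intro a d v w ha hd
    refine (norm_add_le _ _).trans ?_
    rw [norm_smul, norm_smul, Real.norm_eq_abs, Real.norm_eq_abs]
    exact add_le_add (mul_le_of_le_one_left (norm_nonneg _) ha)
      (mul_le_of_le_one_left (norm_nonneg _) hd)
  refine ⟨b, -c, squeeze_zero_norm (fun t => ?_) hbc0, squeeze_zero_norm (fun t => ?_) hbc0,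
    norm_eq_one_of_inner hbb, by rw [norm_neg]; exact norm_eq_one_of_inner hcc,
    by rw [inner_neg_right, hbc, neg_zero], fun z hXz hZz => ?_⟩
  · have e : X t - bCirc b (-c) t = C t • ((C t • X t - S t • Z t) - b)
        + S t • ((S t • X t + C t • Z t) - c) := by
      rw [bCirc]
      match_scalars
      · linear_combination -hCS t
      all_goals simp only [hC, hS]; ring
    rw [e]
    exact small _ _ _ _ (hC1 t) (hS1 t)
  · have e : Z t - v2Circ b (-c) t = (-S t) • ((C t • X t - S t • Z t) - b)
        + C t • ((S t • X t + C t • Z t) - c) := by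
      rw [v2Circ]
      match_scalars
      · linear_combination -hCS t
      all_goals simp only [hC, hS]; ring
    rw [e]
    exact small _ _ _ _ (by rw [abs_neg]; exact hS1 t) (hC1 t)
  · have hXa : Tendsto (fun t => |inner ℝ (X t) z| + |inner ℝ (Z t) z|) atTop (𝓝 (0 : ℝ)) := by
      simpa using hXz.abs.add hZz.abs
    have sm : ∀ a d p q : ℝ, |a| ≤ 1 → |d| ≤ 1 → |a * p + d * q| ≤ |p| + |q| := by
      intro a d p q ha hd
      refine (abs_add_le _ _).trans ?_
      rw [abs_mul, abs_mul]
      exact add_le_add (mul_le_of_le_one_left (abs_nonneg _) ha)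
        (mul_le_of_le_one_left (abs_nonneg _) hd)
    constructor
    · refine tendsto_nhds_unique (hb.inner tendsto_const_nhds)
        (squeeze_zero_norm (fun t => ?_) hXa)
      rw [inner_sub_left, real_inner_smul_left, real_inner_smul_left, Real.norm_eq_abs,
        sub_eq_add_neg, ← neg_mul]
      exact sm _ _ _ _ (hC1 t) (by rw [abs_neg]; exact hS1 t)
    · rw [inner_neg_left, neg_eq_zero]
      refine tendsto_nhds_unique (hc.inner tendsto_const_nhds)
        (squeeze_zero_norm (fun t => ?_) hXa)
      rw [inner_add_left, real_inner_smul_left, real_inner_smul_left, Real.norm_eq_abs]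
      exact sm _ _ _ _ (hS1 t) (hC1 t)

theorem ConvergesUniformly.of_le {M N : ℝ → ℝ → E4} {E : ℝ → ℝ} (hE : Tendsto E atTop (𝓝 0))
    (hle : ∀ᶠ t in atTop, ∀ y, ‖M t y - N t y‖ ≤ E t) : ConvergesUniformly M N := by
  intro ε hε
  obtain ⟨T, hT⟩ := eventually_atTop.1 (hle.and (hE.eventually_lt_const hε))
  exact ⟨T, fun t ht y => ((hT t ht.le).1 y).trans_lt (hT t ht.le).2⟩

section Circle

variable {b c : E4}

theorem norm_bCirc (hb : ‖b‖ = 1) (hc : ‖c‖ = 1) (hbc : inner ℝ b c = (0 : ℝ)) (t : ℝ) :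
    ‖bCirc b c t‖ = 1 := by
  have hbb : inner ℝ b b = (1 : ℝ) := by rw [real_inner_self_eq_norm_sq, hb, one_pow]
  have hcc : inner ℝ c c = (1 : ℝ) := by rw [real_inner_self_eq_norm_sq, hc, one_pow]
  refine norm_eq_one_of_inner ?_
  rw [bCirc]
  simp only [inner_sub_left, inner_sub_right, real_inner_smul_left, real_inner_smul_right, hbc,
    real_inner_comm b c, hbb, hcc]
  linear_combination Real.cos_sq_add_sin_sq (√5 * t / 2)

theorem range_add_smul_bCirc (hb : ‖b‖ = 1) (hc : ‖c‖ = 1) (hbc : inner ℝ b c = (0 : ℝ))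
    (p : E4) (s : ℝ) :
    range (fun t => p + s • bCirc b c t) = planeCircle b c p |s| := by
  ext z
  constructor
  · rintro ⟨t, rfl⟩
    refine ⟨?_, ?_⟩
    · simp [dist_eq_norm, norm_smul, norm_bCirc hb hc hbc]
    · refine Submodule.mem_span_pair.2
        ⟨s * Real.cos (√5 * t / 2), -(s * Real.sin (√5 * t / 2)), ?_⟩
      simp only [bCirc]
      module
  · rintro ⟨h1, h2⟩
    obtain ⟨k, l, hkl⟩ := Submodule.mem_span_pair.1 h2
    have hn : k ^ 2 + l ^ 2 = s ^ 2 := by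
      have hbb : inner ℝ b b = (1 : ℝ) := by rw [real_inner_self_eq_norm_sq, hb, one_pow]
      have hcc : inner ℝ c c = (1 : ℝ) := by rw [real_inner_self_eq_norm_sq, hc, one_pow]
      have e : inner ℝ (z - p) (z - p) = k ^ 2 + l ^ 2 := by
        rw [← hkl]
        simp only [inner_add_left, inner_add_right, real_inner_smul_left, real_inner_smul_right,
          hbc, real_inner_comm b c, hbb, hcc]
        ring
      rw [← e, real_inner_self_eq_norm_sq, ← dist_eq_norm, h1, sq_abs]
    obtain ⟨θ, h3, h4⟩ : ∃ θ : ℝ, s * Real.cos θ = k ∧ -(s * Real.sin θ) = l := by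
      by_cases hs : s = 0
      · subst hs
        refine ⟨0, ?_, ?_⟩ <;> nlinarith
      · set w : ℂ := ⟨k / s, -(l / s)⟩ with hw
        have hw1 : ‖w‖ = 1 := by
          have : ‖w‖ ^ 2 = 1 := by
            rw [← Complex.normSq_eq_norm_sq, Complex.normSq_mk]
            field_simp
            linear_combination hn
          exact (pow_eq_one_iff_of_nonneg (norm_nonneg w) two_ne_zero).1 this
        have hw0 : w ≠ 0 := fun h0 => by rw [h0] at hw1; simp at hw1
        refine ⟨w.arg, ?_, ?_⟩
        · rw [Complex.cos_arg hw0, hw1, hw]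
          field_simp
        · rw [Complex.sin_arg, hw1, hw]
          field_simp
    refine ⟨2 * θ / √5, ?_⟩
    have e : √5 * (2 * θ / √5) / 2 = θ := by
      have : √5 ≠ 0 := by positivity
      field_simp
    simp only [bCirc, e]
    have hz : z = p + (k • b + l • c) := by rw [hkl]; abel
    rw [hz, ← h3, ← h4]
    module

theorem v2Circ_eq (b c : E4) (t : ℝ) : v2Circ b c t = bCirc (-c) b t := by
  rw [v2Circ, bCirc]
  module

theorem norm_v2Circ (hb : ‖b‖ = 1) (hc : ‖c‖ = 1) (hbc : inner ℝ b c = (0 : ℝ)) (t : ℝ) :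
    ‖v2Circ b c t‖ = 1 := by
  rw [v2Circ_eq]
  exact norm_bCirc (by rwa [norm_neg]) hb (by rw [inner_neg_left, real_inner_comm, hbc, neg_zero]) t

theorem range_add_smul_v2Circ (hb : ‖b‖ = 1) (hc : ‖c‖ = 1) (hbc : inner ℝ b c = (0 : ℝ))
    (p : E4) (s : ℝ) :
    range (fun t => p + s • v2Circ b c t) = planeCircle b c p |s| := by
  have hspan : Submodule.span ℝ {-c, b} = Submodule.span ℝ {b, c} := by
    rw [Set.pair_comm, Submodule.span_insert, Submodule.span_insert, ← Set.neg_singleton,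
      Submodule.span_neg]
  have := range_add_smul_bCirc (b := -c) (c := b) (by rwa [norm_neg]) hb
    (by rw [inner_neg_left, real_inner_comm, hbc, neg_zero]) p s
  simp only [v2Circ_eq]
  rw [this, planeCircle, planeCircle, hspan]

theorem deformsContinuously_add_smul (hb : ‖b‖ = 1) (hc : ‖c‖ = 1) (hbc : inner ℝ b c = (0 : ℝ))
    {p : ℝ → E4} {s : ℝ → ℝ} (hp : Continuous p) (hs : Continuous s) :
    DeformsContinuously (fun t y => p y + s y • v2Circ b c t) := by
  intro y₀
  rw [Metric.tendstoUniformly_iff]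
  intro ε hε
  have h1 := (Metric.continuous_iff'.1 hp) y₀ (ε / 2) (by positivity)
  have h2 := (Metric.continuous_iff'.1 hs) y₀ (ε / 2) (by positivity)
  filter_upwards [h1, h2] with y hy1 hy2 t
  have e : (p y₀ + s y₀ • v2Circ b c t) - (p y + s y • v2Circ b c t)
      = -(p y - p y₀) - (s y - s y₀) • v2Circ b c t := by module
  rw [dist_eq_norm, e]
  refine (norm_sub_le _ _).trans_lt ?_
  rw [norm_neg, norm_smul, norm_v2Circ hb hc hbc, mul_one]
  rw [dist_eq_norm] at hy1 hy2
  linarith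

end Circle

/-- The component of `fVec` in the direction of `vVec`. -/
def αC (x y : ℝ) : ℝ := (mC x y - 2 * √(1 + y ^ 2) * kC x y) / √(5 + 4 * y ^ 2)

/-- The component of `(2 √(1 + y²) w + ξ) / √(5 + 4 y²)` in the direction of `vVec`. -/
def βC (x y : ℝ) : ℝ := (2 * √(1 + y ^ 2) * mC x y + kC x y) / √(5 + 4 * y ^ 2)

theorem fVec_decomp (F : ℝ → ℝ → Fin 4 → E4) {x : ℝ} (hq : 0 < X0q x) (y : ℝ) :
    fVec F x y = αC x y • vVec F x y + βC x y • nVec F x y + (nC x y * αC x y) • F x y 1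
      + nC x y ^ 2 • fVec F x y := by
  have hR := (sqrt_five_add_pos y).ne'
  have h1 := m_sq_add hq y
  rw [fVec_eq, vVec, nVec, αC, βC]
  match_scalars
  · field_simp
    linear_combination -h1
  · field_simp
    linear_combination 2 * √(1 + y ^ 2) * h1
  · field_simp
    ring

theorem αC_sq_add {x : ℝ} (hq : 0 < X0q x) (y : ℝ) : αC x y ^ 2 + βC x y ^ 2 ≤ 1 := by
  have h1 := m_sq_add hq y
  have e : αC x y ^ 2 + βC x y ^ 2 = mC x y ^ 2 + kC x y ^ 2 := by
    have hR := (sqrt_five_add_pos y).ne'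
    rw [αC, βC, div_pow, div_pow, ← add_div, div_eq_iff (by positivity), sq_sqrt_five_add]
    linear_combination 4 * (mC x y ^ 2 + kC x y ^ 2) * sq_sqrt_one_add y
  nlinarith [sq_nonneg (nC x y)]

theorem abs_αC_le {x : ℝ} (hq : 0 < X0q x) (y : ℝ) : |αC x y| ≤ 1 := by
  rw [← sq_le_one_iff_abs_le_one]
  nlinarith [αC_sq_add hq y, sq_nonneg (βC x y)]

theorem abs_βC_le {x : ℝ} (hq : 0 < X0q x) (y : ℝ) : |βC x y| ≤ 1 := by
  rw [← sq_le_one_iff_abs_le_one]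
  nlinarith [αC_sq_add hq y, sq_nonneg (αC x y)]

/-- A bound for `|h(x, y) - h(0, y)| / (1 + y²)`. -/
def hErr (x : ℝ) : ℝ := |2 * X0 x - x ^ 2 * X0q x - 5| + |X0q x - 2|

theorem abs_h_sub_le (x y : ℝ) : |h x y - h 0 y| ≤ hErr x * (1 + y ^ 2) := by
  have e : h x y - h 0 y = (2 * X0 x - x ^ 2 * X0q x - 5) + (X0q x - 2) * y ^ 2 := by
    rw [h_eq, h_zero]; ring
  rw [e, hErr]
  refine (abs_add_le _ _).trans ?_
  rw [abs_mul, abs_of_nonneg (sq_nonneg y)]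
  nlinarith [abs_nonneg (2 * X0 x - x ^ 2 * X0q x - 5), abs_nonneg (X0q x - 2), sq_nonneg y,
    mul_nonneg (abs_nonneg (2 * X0 x - x ^ 2 * X0q x - 5)) (sq_nonneg y)]

theorem tendsto_hErr : Tendsto (fun t : ℝ => hErr (Real.exp (-t))) atTop (𝓝 0) := by
  have hc : Continuous hErr := by
    have := continuous_X0; have := continuous_X0q
    unfold hErr
    fun_prop
  have := (hc.tendsto 0).comp tendsto_exp_neg
  have h0 : hErr 0 = 0 := by
    rw [hErr, X0_zero, X0q_zero]
    norm_num
  rwa [h0] at this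

theorem two_div_mul_v2 (y : ℝ) :
    2 / √5 * v2 0 y = (1 + 4 * √5 * (1 + y ^ 2) / h 0 y) / √(5 + 4 * y ^ 2) := by
  have hR := (sqrt_five_add_pos y).ne'
  have h5 : √5 ≠ 0 := by positivity
  have hh : 5 + √5 + 2 * y ^ 2 ≠ 0 := by positivity
  rw [v2, h_zero, X0_zero]
  field_simp
  linear_combination (-5 - 4 * y ^ 2) * sqrt_five_sq

theorem two_div_mul_v3 (y : ℝ) :
    2 / √5 * v3 0 y = -(4 * y ^ 2 / h 0 y * (√(1 + y ^ 2) / √(5 + 4 * y ^ 2))) := by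
  have h5 : √5 ≠ 0 := by positivity
  rw [v3, Real.sqrt_div (by positivity)]
  field_simp
  ring

theorem v2_sq_add_v3_sq (y : ℝ) : v2 0 y ^ 2 + v3 0 y ^ 2 = 5 / 4 := by
  have hR := (sqrt_five_add_pos y).ne'
  have hh : 5 + √5 + 2 * y ^ 2 ≠ 0 := by positivity
  rw [v2, v3, h_zero, X0_zero, mul_pow _ (√((1 + y ^ 2) / (5 + 4 * y ^ 2))),
    Real.sq_sqrt (by positivity), mul_pow, mul_pow, inv_pow, sq_sqrt_five_add]
  field_simp
  linear_combination 16 * y ^ 4 * (5 + 4 * y ^ 2) * sqrt_five_sq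

theorem h_zero_ge (y : ℝ) : 1 + y ^ 2 ≤ h 0 y := by
  rw [h_zero]
  nlinarith [sq_nonneg y, lt_sqrt_five]

theorem one_le_sqrt_five_add (y : ℝ) : 1 ≤ √(5 + 4 * y ^ 2) := by
  rw [Real.one_le_sqrt]
  nlinarith [sq_nonneg y]

theorem abs_div_sub_div_le {x : ℝ} (hx : IsSmall x) (y : ℝ) {a : ℝ} {k : ℝ} (hk : 0 ≤ k)
    (ha : 0 ≤ a) (hak : a ≤ k * (1 + y ^ 2)) : |a / h x y - a / h 0 y| ≤ k * hErr x := by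
  have h1 := hx.le_h y
  have h2 := h_zero_ge y
  have hY : 0 < 1 + y ^ 2 := by positivity
  have p1 : 0 < h x y := hY.trans_le h1
  have p2 : 0 < h 0 y := hY.trans_le h2
  have e : a / h x y - a / h 0 y = a * (h 0 y - h x y) / (h x y * h 0 y) := by
    field_simp
  have hd := abs_h_sub_le x y
  have hE : 0 ≤ hErr x := by unfold hErr; positivity
  rw [e, abs_div, abs_mul, abs_of_nonneg ha, abs_of_pos (mul_pos p1 p2), abs_sub_comm,
    div_le_iff₀ (mul_pos p1 p2)]
  calc a * |h x y - h 0 y| ≤ k * (1 + y ^ 2) * (hErr x * (1 + y ^ 2)) := by gcongr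
    _ = k * hErr x * ((1 + y ^ 2) * (1 + y ^ 2)) := by ring
    _ ≤ k * hErr x * (h x y * h 0 y) := by gcongr

theorem abs_αC_add_le {x : ℝ} (hx : IsSmall x) (y : ℝ) :
    |αC x y + 2 / √5 * v2 0 y| ≤ 10 * hErr x := by
  have hR := sqrt_five_add_pos y
  have hh := (h_pos hx.q_pos y).ne'
  have e : αC x y + 2 / √5 * v2 0 y = -(4 * √5 * (1 + y ^ 2) / h x y
      - 4 * √5 * (1 + y ^ 2) / h 0 y) / √(5 + 4 * y ^ 2) := by
    have e1 : mC x y - 2 * √(1 + y ^ 2) * kC x y = -1 - 4 * √5 * (1 + y ^ 2) / h x y := by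
      rw [mC, kC]
      field_simp
      linear_combination -2 * (X0q x + 2 * √5) * sq_sqrt_one_add y
    rw [αC, two_div_mul_v2, e1]
    ring
  rw [e, abs_div, abs_neg, abs_of_pos hR]
  refine (div_le_self (abs_nonneg _) (one_le_sqrt_five_add y)).trans ?_
  refine abs_div_sub_div_le hx y (by norm_num) (by positivity) ?_
  have := sqrt_five_lt
  gcongr
  linarith

theorem abs_βC_add_le {x : ℝ} (hx : IsSmall x) (y : ℝ) :
    |βC x y + 2 / √5 * v3 0 y| ≤ 20 * hErr x := by
  have hR := sqrt_five_add_pos y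
  have hr := sqrt_one_add_pos y
  have hh := h_pos hx.q_pos y
  have hh0 : 0 < h 0 y := lt_of_lt_of_le (by positivity) (h_zero_ge y)
  have e : βC x y + 2 / √5 * v3 0 y = √(1 + y ^ 2) / √(5 + 4 * y ^ 2) *
      ((X0q x - 2) * ((5 + 4 * y ^ 2) / h x y) + ((10 + 8 * y ^ 2 + 2 * √5) / h x y
        - (10 + 8 * y ^ 2 + 2 * √5) / h 0 y)) := by
    have e0 : 4 * y ^ 2 / h 0 y = (10 + 8 * y ^ 2 + 2 * √5) / h 0 y - 2 := by
      field_simp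
      rw [h_zero]
      ring
    rw [βC, two_div_mul_v3, e0, mC, kC]
    field_simp
    ring
  have hrR : √(1 + y ^ 2) / √(5 + 4 * y ^ 2) ≤ 1 := by
    rw [div_le_one hR]
    exact Real.sqrt_le_sqrt (by nlinarith [sq_nonneg y])
  have h1 : |(X0q x - 2) * ((5 + 4 * y ^ 2) / h x y)| ≤ 5 * hErr x := by
    have : (5 + 4 * y ^ 2) / h x y ≤ 5 := by
      rw [div_le_iff₀ hh]
      nlinarith [hx.le_h y, sq_nonneg y]
    have h2 : |X0q x - 2| ≤ hErr x := by
      rw [hErr]; linarith [abs_nonneg (2 * X0 x - x ^ 2 * X0q x - 5)]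
    rw [abs_mul, abs_of_nonneg (by positivity : 0 ≤ (5 + 4 * y ^ 2) / h x y)]
    nlinarith [mul_le_mul h2 this (by positivity) ((abs_nonneg _).trans h2)]
  have h2 : |(10 + 8 * y ^ 2 + 2 * √5) / h x y - (10 + 8 * y ^ 2 + 2 * √5) / h 0 y|
      ≤ 15 * hErr x := by
    refine abs_div_sub_div_le hx y (by norm_num) (by positivity) ?_
    nlinarith [sqrt_five_lt, sq_nonneg y]
  rw [e, abs_mul, abs_of_nonneg (by positivity : 0 ≤ √(1 + y ^ 2) / √(5 + 4 * y ^ 2))]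
  calc _ ≤ 1 * (5 * hErr x + 15 * hErr x) := by
        gcongr
        exact (abs_add_le _ _).trans (add_le_add h1 h2)
    _ = _ := by ring

theorem tendsto_h_zero : Tendsto (fun t : ℝ => h (Real.exp (-t)) 0) atTop (𝓝 (5 + √5)) := by
  have hc : Continuous fun x => h x 0 := by
    have := continuous_X0; have := continuous_X0q
    simp only [h_eq]
    fun_prop
  have := (hc.tendsto 0).comp tendsto_exp_neg
  have h0 : h 0 0 = 5 + √5 := by rw [h_zero]; ring
  rwa [h0] at this

theorem tendsto_mC_zero :
    Tendsto (fun t : ℝ => mC (Real.exp (-t)) 0) atTop (𝓝 (-(√5)⁻¹)) := by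
  have h5 : √5 ≠ 0 := by positivity
  have h6 : 5 + √5 ≠ 0 := by positivity
  have h1 := ((tendsto_X0q.const_mul 2).div tendsto_h_zero h6).sub_const 1
  have e : 2 * 2 / (5 + √5) - 1 = -(√5)⁻¹ := by
    field_simp
    linear_combination -sqrt_five_sq
  rw [e] at h1
  refine h1.congr fun t => ?_
  simp [mC]

theorem tendsto_kC_zero :
    Tendsto (fun t : ℝ => kC (Real.exp (-t)) 0) atTop (𝓝 (2 * (√5)⁻¹)) := by
  have h5 : √5 ≠ 0 := by positivity
  have h6 : 5 + √5 ≠ 0 := by positivity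
  have h1 := (tendsto_X0q.add_const (2 * √5)).div tendsto_h_zero h6
  have e : (2 + 2 * √5) / (5 + √5) = 2 * (√5)⁻¹ := by
    field_simp
    linear_combination sqrt_five_sq
  rw [e] at h1
  refine h1.congr fun t => ?_
  simp [kC]

theorem tendsto_nVec_zero {F : ℝ → ℝ → Fin 4 → E4} (hF : IsFrameField F) :
    Tendsto (fun t => nVec F (Real.exp (-t)) 0 + zVec F (Real.exp (-t))) atTop (𝓝 0) := by
  have hk : Tendsto (fun t : ℝ => |kC (Real.exp (-t)) 0 - 2 * (√5)⁻¹|) atTop (𝓝 0) := by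
    simpa using (tendsto_kC_zero.sub_const (2 * (√5)⁻¹)).abs
  have hm : Tendsto (fun t : ℝ => |-(mC (Real.exp (-t)) 0 + (√5)⁻¹)|) atTop (𝓝 0) := by
    simpa only [neg_add_cancel, neg_zero, abs_zero] using
      (tendsto_mC_zero.add_const (√5)⁻¹).neg.abs
  have hkm := hk.add hm
  rw [add_zero] at hkm
  refine squeeze_zero_norm (fun t => ?_) hkm
  have e : nVec F (Real.exp (-t)) 0 + zVec F (Real.exp (-t))
      = (kC (Real.exp (-t)) 0 - 2 * (√5)⁻¹) • F (Real.exp (-t)) 0 2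
        + (-(mC (Real.exp (-t)) 0 + (√5)⁻¹)) • F (Real.exp (-t)) 0 3 := by
    have : wVec F (Real.exp (-t)) 0 = F (Real.exp (-t)) 0 2 := by simp [wVec]
    rw [nVec, zVec, this]
    module
  rw [e]
  refine (norm_add_le _ _).trans ?_
  rw [norm_smul_unit (hF.norm_eq (Real.exp_pos _) _ _),
    norm_smul_unit (hF.norm_eq (Real.exp_pos _) _ _)]

theorem IsFrameField.tendsto_inner_z_v {F : ℝ → ℝ → Fin 4 → E4} (hF : IsFrameField F) :
    Tendsto (fun t => inner ℝ (zVec F (Real.exp (-t))) (vVec F (Real.exp (-t)) 0)) atTop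
      (𝓝 (0 : ℝ)) := by
  have h1 := ((tendsto_mC_zero.const_mul 2).add tendsto_kC_zero).const_mul (-(√5)⁻¹)
  have e : -(√5)⁻¹ * (2 * -(√5)⁻¹ + 2 * (√5)⁻¹) = 0 := by ring
  rw [e] at h1
  refine h1.congr fun t => ?_
  have : wVec F (Real.exp (-t)) 0 = F (Real.exp (-t)) 0 2 := by simp [wVec]
  simp only [vVec, zVec, this, inner_neg_left, inner_add_left, inner_add_right, inner_sub_right,
    real_inner_smul_left, real_inner_smul_right, hF.inner_eq (Real.exp_pos _)]
  simp
  ring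

theorem IsFrameField.inner_Xα_v {F : ℝ → ℝ → Fin 4 → E4} (hF : IsFrameField F) {x : ℝ}
    (hx : 0 < x) (y : ℝ) : inner ℝ (F x y 1) (vVec F x y) = -nC x y := by
  simp only [vVec, inner_add_right, inner_sub_right, real_inner_smul_right, hF.inner_Xα_w hx,
    hF.inner_eq hx]
  simp

theorem inner_u_v_eq_zero {u v : ℝ → E4} {s : ℝ → ℝ} (hu : ∀ y, HasDerivAt u (s y • v y) y)
    (hv : ∀ y, HasDerivAt v (-(s y • u y)) y) {z : E4} (h1 : inner ℝ z (u 0) = (0 : ℝ))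
    (h2 : inner ℝ z (v 0) = (0 : ℝ)) (y : ℝ) :
    inner ℝ z (u y) = (0 : ℝ) ∧ inner ℝ z (v y) = (0 : ℝ) := by
  have d1 : ∀ y, HasDerivAt (fun y => inner ℝ z (u y)) (s y * inner ℝ z (v y)) y := fun y => by
    refine ((hasDerivAt_const y z).inner ℝ (hu y)).congr_deriv ?_
    simp [real_inner_smul_right]
  have d2 : ∀ y, HasDerivAt (fun y => inner ℝ z (v y)) (-(s y * inner ℝ z (u y))) y := fun y => by
    refine ((hasDerivAt_const y z).inner ℝ (hv y)).congr_deriv ?_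
    simp [real_inner_smul_right]
  have d : ∀ y, HasDerivAt (fun y => inner ℝ z (u y) ^ 2 + inner ℝ z (v y) ^ 2) (0 : ℝ) y :=
    fun y => (((d1 y).pow 2).add ((d2 y).pow 2)).congr_deriv (by simp; ring)
  have hc : inner ℝ z (u y) ^ 2 + inner ℝ z (v y) ^ 2
      = inner ℝ z (u 0) ^ 2 + inner ℝ z (v 0) ^ 2 :=
    is_const_of_deriv_eq_zero (fun y => (d y).differentiableAt) (fun y => (d y).deriv) y 0
  rw [h1, h2] at hc
  constructor <;> nlinarith [sq_nonneg (inner ℝ z (u y)), sq_nonneg (inner ℝ z (v y))]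

theorem IsFrameField.norm_f {F : ℝ → ℝ → Fin 4 → E4} (hF : IsFrameField F) {x : ℝ}
    (hx : 0 < x) (y : ℝ) : ‖fVec F x y‖ = 1 :=
  norm_eq_one_of_inner (hF.inner_f_f hx y)

theorem radS_nonneg (y : ℝ) : 0 ≤ radS y := by rw [radS]; positivity

theorem radS_le_one (y : ℝ) : radS y ≤ 1 := by
  have hr := sqrt_one_add_pos y
  have h5 := lt_sqrt_five
  rw [radS_eq, div_le_one (by positivity)]
  have : √(5 + 4 * y ^ 2) ≤ √5 * √(1 + y ^ 2) := by
    rw [← Real.sqrt_mul (by norm_num)]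
    exact Real.sqrt_le_sqrt (by nlinarith [sq_nonneg y])
  nlinarith [mul_pos (by linarith : 0 < √5) hr]

theorem continuous_h_zero : Continuous fun y => h 0 y := by
  simp only [h_zero]
  fun_prop

theorem h_zero_ne (y : ℝ) : h 0 y ≠ 0 := by rw [h_zero]; positivity

theorem continuous_v2_zero : Continuous fun y => v2 0 y := by
  have := continuous_h_zero.inv₀ h_zero_ne
  have h2 : Continuous fun y : ℝ => (√(5 + 4 * y ^ 2))⁻¹ :=
    (by fun_prop : Continuous fun y : ℝ => √(5 + 4 * y ^ 2)).inv₀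
      fun y => (sqrt_five_add_pos y).ne'
  exact (h2.mul this).mul (by fun_prop)

theorem continuous_v3_zero : Continuous fun y => v3 0 y := by
  have := continuous_h_zero.inv₀ h_zero_ne
  have h2 : Continuous fun y : ℝ => (1 + y ^ 2) / (5 + 4 * y ^ 2) :=
    (by fun_prop : Continuous fun y : ℝ => 1 + y ^ 2).div (by fun_prop) fun y => by positivity
  exact ((by fun_prop : Continuous fun y : ℝ => 2 * √5 * ((0 : ℝ) ^ 2 - y ^ 2)).mul this).mul
    h2.sqrt

theorem continuous_radS : Continuous radS := by
  have h2 : Continuous fun y : ℝ => (5 + 4 * y ^ 2) / (1 + y ^ 2) :=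
    (by fun_prop : Continuous fun y : ℝ => 5 + 4 * y ^ 2).div (by fun_prop) fun y => by positivity
  unfold radS
  fun_prop

theorem IsFrameField.continuous_fVec {F : ℝ → ℝ → Fin 4 → E4} (hF : IsFrameField F) {x : ℝ}
    (hx : 0 < x) : Continuous (fVec F x) := by
  have hc : ∀ j, Continuous fun y => F x y j := fun j =>
    continuous_iff_continuousAt.2 fun y => (hF.deriv_y x y hx j).continuousAt
  have h0 := hc 0
  have h2 := hc 2
  have h3 := hc 3
  have hS : Continuous fun y : ℝ => (√((1 + y ^ 2) * (5 + 4 * y ^ 2)))⁻¹ :=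
    (by fun_prop : Continuous fun y : ℝ => √((1 + y ^ 2) * (5 + 4 * y ^ 2))).inv₀
      fun y => (Real.sqrt_pos.2 (by positivity)).ne'
  unfold fVec
  fun_prop

theorem two_div_sqrt_five_sq : (2 / √5) ^ 2 = (4 / 5 : ℝ) := by
  rw [div_pow, sqrt_five_sq]; norm_num

theorem aCirc_eq (b c : E4) (v₁ : ℝ → E4) (t y : ℝ) : aCirc b c v₁ t y
    = -((2 / √5 * v2 0 y) • v₁ y) + (2 / √5 * v3 0 y) • v2Circ b c t := by
  rw [aCirc]
  module

theorem Γ_eq (b c : E4) (v₁ A : ℝ → E4) (t y : ℝ) : Γ b c v₁ A t y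
    = (A y - (radS y * (2 / √5 * v2 0 y)) • v₁ y)
      + (radS y * (2 / √5 * v3 0 y)) • v2Circ b c t := by
  rw [Γ, aCirc]
  module

theorem inner_v2Circ {b c z : E4} (hb : inner ℝ b z = (0 : ℝ)) (hc : inner ℝ c z = (0 : ℝ))
    (t : ℝ) : inner ℝ (v2Circ b c t) z = (0 : ℝ) := by
  simp [v2Circ, inner_sub_left, real_inner_smul_left, hb, hc]

theorem norm_aCirc {b c : E4} {v₁ : ℝ → E4} (hb : ‖b‖ = 1) (hc : ‖c‖ = 1)
    (hbc : inner ℝ b c = (0 : ℝ)) {y : ℝ} (hv : inner ℝ (v₁ y) (v₁ y) = (1 : ℝ))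
    (hbv : inner ℝ b (v₁ y) = (0 : ℝ)) (hcv : inner ℝ c (v₁ y) = (0 : ℝ)) (t : ℝ) :
    ‖aCirc b c v₁ t y‖ = 1 := by
  have h1 := inner_v2Circ hbv hcv t
  have h2 : inner ℝ (v2Circ b c t) (v2Circ b c t) = (1 : ℝ) := by
    rw [real_inner_self_eq_norm_sq, norm_v2Circ hb hc hbc, one_pow]
  refine norm_eq_one_of_inner ?_
  rw [aCirc_eq]
  simp only [inner_add_left, inner_add_right, inner_neg_left, inner_neg_right,
    real_inner_smul_left, real_inner_smul_right, h1, h2, hv,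
    real_inner_comm (v2Circ b c t) (v₁ y)]
  linear_combination (v2 0 y ^ 2 + v3 0 y ^ 2) * two_div_sqrt_five_sq
    + 4 / 5 * v2_sq_add_v3_sq y

theorem abs_radS_mul (y : ℝ) :
    |radS y * (2 / √5 * v3 0 y)| = 2 * y ^ 2 / (√5 * h 0 y) := by
  have hr := sqrt_one_add_pos y
  have hR := sqrt_five_add_pos y
  have hh : 0 < h 0 y := lt_of_lt_of_le (by positivity) (h_zero_ge y)
  have e : radS y * (2 / √5 * v3 0 y) = -(2 * y ^ 2 / (√5 * h 0 y)) := by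
    rw [two_div_mul_v3, radS_eq]
    field_simp
    ring
  rw [e, abs_neg, abs_of_nonneg (by positivity)]

theorem v3_zero_zero : v3 0 0 = 0 := by simp [v3]

theorem two_div_mul_v2_zero : 2 / √5 * v2 0 0 = 1 := by
  have e : √(5 + 4 * (0 : ℝ) ^ 2) = √5 := by norm_num
  have h5 : √5 ≠ 0 := by positivity
  rw [two_div_mul_v2, e, h_zero]
  have h6 : 5 + √5 + 2 * (0 : ℝ) ^ 2 ≠ 0 := by positivity
  field_simp
  linear_combination -sqrt_five_sq

theorem radS_zero : radS 0 = 1 / 2 := by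
  have e : √((5 + 4 * (0 : ℝ) ^ 2) / (1 + 0 ^ 2)) = √5 := by norm_num
  have h5 : √5 ≠ 0 := by positivity
  rw [radS, e]
  field_simp

/-- As `x → 0`, `X_α` and `-nVec` approach `bCirc` and `v2Circ`, uniformly in `y`. -/
theorem exists_tendsto_zero_bound {F : ℝ → ℝ → Fin 4 → E4} (hF : IsFrameField F) {b c : E4}
    (hX : Tendsto (fun t => F (Real.exp (-t)) 0 1 - bCirc b c t) atTop (𝓝 0))
    (hZ : Tendsto (fun t => zVec F (Real.exp (-t)) - v2Circ b c t) atTop (𝓝 0)) :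
    ∃ E : ℝ → ℝ, Tendsto E atTop (𝓝 0) ∧ ∀ᶠ t in atTop, ∀ y,
      ‖F (Real.exp (-t)) y 1 - bCirc b c t‖ ≤ E t ∧
      ‖nVec F (Real.exp (-t)) y + v2Circ b c t‖ ≤ E t := by
  refine ⟨fun t => ‖F (Real.exp (-t)) 0 1 - bCirc b c t‖ +
    (‖nVec F (Real.exp (-t)) 0 + zVec F (Real.exp (-t))‖ +
      ‖zVec F (Real.exp (-t)) - v2Circ b c t‖) + 84 * |X0p (Real.exp (-t))|, ?_, ?_⟩
  · simpa using (hX.norm.add ((tendsto_nVec_zero hF).norm.add hZ.norm)).add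
      (tendsto_abs_X0p.const_mul 84)
  · filter_upwards [eventually_isSmall] with t ht y
    have hB := hF.bVec_sub_le ht y
    have hN := hF.nVec_sub_le ht y
    have hv : ∀ y, ‖nC (Real.exp (-t)) y • vVec F (Real.exp (-t)) y‖
        ≤ 2 * |X0p (Real.exp (-t))| := fun y => by
      rw [norm_smul_unit (norm_eq_one_of_inner (hF.inner_v_v ht.pos ht.q_pos y))]
      exact nC_abs_le_two_mul ht y
    have hy := hv y
    have h0 := hv 0
    generalize Real.exp (-t) = x at *
    constructor
    · have e : F x y 1 - bCirc b c t = (bVec F x y - bVec F x 0) - nC x y • vVec F x y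
          + nC x 0 • vVec F x 0 + (F x 0 1 - bCirc b c t) := by
        rw [bVec, bVec]
        abel
      rw [e]
      have i1 := norm_add_le ((bVec F x y - bVec F x 0) - nC x y • vVec F x y
          + nC x 0 • vVec F x 0) (F x 0 1 - bCirc b c t)
      have i2 := norm_add_le ((bVec F x y - bVec F x 0) - nC x y • vVec F x y)
          (nC x 0 • vVec F x 0)
      have i3 := norm_sub_le (bVec F x y - bVec F x 0) (nC x y • vVec F x y)
      linarith [norm_nonneg (nVec F x 0 + zVec F x), norm_nonneg (zVec F x - v2Circ b c t)]
    · have e : nVec F x y + v2Circ b c t = (nVec F x y - nVec F x 0) + (nVec F x 0 + zVec F x)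
          - (zVec F x - v2Circ b c t) := by abel
      rw [e]
      have i1 := norm_sub_le ((nVec F x y - nVec F x 0) + (nVec F x 0 + zVec F x))
        (zVec F x - v2Circ b c t)
      have i2 := norm_add_le (nVec F x y - nVec F x 0) (nVec F x 0 + zVec F x)
      linarith [norm_nonneg (F x 0 1 - bCirc b c t), abs_nonneg (X0p x)]

theorem norm_fVec_sub_le {F : ℝ → ℝ → Fin 4 → E4} (hF : IsFrameField F) {b c : E4}
    (hb : ‖b‖ = 1) (hc : ‖c‖ = 1) (hbc : inner ℝ b c = (0 : ℝ)) {x : ℝ} (hx : IsSmall x)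
    {v₁ : ℝ → E4} {y : ℝ} (hv : vVec F x y = v₁ y) (t : ℝ) :
    ‖fVec F x y - aCirc b c v₁ t y‖
      ≤ 30 * hErr x + ‖nVec F x y + v2Circ b c t‖ + 4 * |X0p x| := by
  have e : fVec F x y - aCirc b c v₁ t y
      = (αC x y + 2 / √5 * v2 0 y) • v₁ y + βC x y • (nVec F x y + v2Circ b c t)
        - (βC x y + 2 / √5 * v3 0 y) • v2Circ b c t
        + (nC x y * αC x y) • F x y 1 + nC x y ^ 2 • fVec F x y := by
    nth_rewrite 1 [fVec_decomp F hx.q_pos y]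
    rw [hv, aCirc_eq]
    module
  have n1 : ‖v₁ y‖ = 1 := hv ▸ norm_eq_one_of_inner (hF.inner_v_v hx.pos hx.q_pos y)
  have i1 : ‖(αC x y + 2 / √5 * v2 0 y) • v₁ y‖ ≤ 10 * hErr x := by
    rw [norm_smul_unit n1]
    exact abs_αC_add_le hx y
  have i2 : ‖βC x y • (nVec F x y + v2Circ b c t)‖ ≤ ‖nVec F x y + v2Circ b c t‖ := by
    rw [norm_smul]
    exact mul_le_of_le_one_left (norm_nonneg _) (abs_βC_le hx.q_pos y)
  have i3 : ‖(βC x y + 2 / √5 * v3 0 y) • v2Circ b c t‖ ≤ 20 * hErr x := by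
    rw [norm_smul_unit (norm_v2Circ hb hc hbc t)]
    exact abs_βC_add_le hx y
  have hn := nC_abs_le_two_mul hx y
  have hn1 := nC_abs_le hx.q_pos y
  have i4 : ‖(nC x y * αC x y) • F x y 1‖ ≤ 2 * |X0p x| := by
    rw [norm_smul_unit (hF.norm_eq hx.pos y 1), abs_mul]
    exact (mul_le_of_le_one_right (abs_nonneg _) (abs_αC_le hx.q_pos y)).trans hn
  have i5 : ‖nC x y ^ 2 • fVec F x y‖ ≤ 2 * |X0p x| := by
    rw [norm_smul_unit (hF.norm_f hx.pos y), abs_pow, sq]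
    exact (mul_le_of_le_one_right (abs_nonneg _) hn1).trans hn
  rw [e]
  refine (norm_add_le _ _).trans ?_
  have j1 := norm_add_le ((αC x y + 2 / √5 * v2 0 y) • v₁ y
    + βC x y • (nVec F x y + v2Circ b c t)
    - (βC x y + 2 / √5 * v3 0 y) • v2Circ b c t) ((nC x y * αC x y) • F x y 1)
  have j2 := norm_sub_le ((αC x y + 2 / √5 * v2 0 y) • v₁ y
    + βC x y • (nVec F x y + v2Circ b c t)) ((βC x y + 2 / √5 * v3 0 y) • v2Circ b c t)
  have j3 := norm_add_le ((αC x y + 2 / √5 * v2 0 y) • v₁ y)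
    (βC x y • (nVec F x y + v2Circ b c t))
  linarith

end

end CurvSurf

theorem mainTheorem6 (F : ℝ → ℝ → Fin 4 → E4) (f : ℝ → ℝ → E4)
    (hf : IsCurvatureSurface F f) :
    ∃ (bInf cInf : E4) (u v₁ A : ℝ → E4),
      -- the vector `u(y)`, the center `A(y)` and the 2-sphere of the `x`-curve
      (∀ x y : ℝ, 0 < x → uVec F x y = u y) ∧
      (∀ x y : ℝ, 0 < x → f x y = radS y • fVec F x y + A y) ∧
      (∀ x y : ℝ, 0 < x → f x y ∈ sphere2 (A y) (u y) (radS y)) ∧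
      -- (1)
      (Continuous v₁ ∧
        (∀ y : ℝ, HasDerivAt u ((y ^ 2 / (1 + y ^ 2)) • v₁ y) y) ∧
        (∀ y : ℝ, Orthonormal ℝ ![u y, v₁ y, bInf, cInf])) ∧
      -- (2)
      (ConvergesUniformly (fun t y => F (Real.exp (-t)) y 1) (fun t _ => bCirc bInf cInf t) ∧
        Set.range (bCirc bInf cInf) = planeCircle bInf cInf 0 1 ∧
        ConvergesUniformly (fun t y => fVec F (Real.exp (-t)) y) (aCirc bInf cInf v₁) ∧
        (∀ y : ℝ, Set.range (fun t => aCirc bInf cInf v₁ t y) =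
          planeCircle bInf cInf (-((2 / √5 * v2 0 y) • v₁ y)) (2 / √5 * |v3 0 y|)) ∧
        DeformsContinuously (aCirc bInf cInf v₁) ∧
        (∀ t : ℝ, aCirc bInf cInf v₁ t 0 = -v₁ 0)) ∧
      -- (3)
      (ConvergesUniformly (fun t y => f (Real.exp (-t)) y) (Γ bInf cInf v₁ A) ∧
        (∀ y : ℝ, Set.range (fun t => Γ bInf cInf v₁ A t y) =
          planeCircle bInf cInf (A y - (radS y * (2 / √5 * v2 0 y)) • v₁ y)
            (2 * y ^ 2 / (√5 * h 0 y))) ∧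
        (∀ t y : ℝ, Γ bInf cInf v₁ A t y ∈ sphere2 (A y) (u y) (radS y)) ∧
        DeformsContinuously (Γ bInf cInf v₁ A) ∧
        (∀ t : ℝ, Γ bInf cInf v₁ A t 0 = -((1 / 2 : ℝ) • v₁ 0) + A 0)) := by
  have hF := hf.frame
  obtain ⟨t₀, ht₀⟩ := eventually_isSmall.exists
  set x₀ := Real.exp (-t₀) with hx₀
  obtain ⟨b, c, hX, hZ, hb, hc, hbc, hperp⟩ := exists_limit_circle hF
  set u : ℝ → E4 := uVec F x₀ with hu
  set v₁ : ℝ → E4 := vVec F x₀ with hv₁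
  set A : ℝ → E4 := fun y => f x₀ y - radS y • fVec F x₀ y with hA
  have huu : ∀ x y : ℝ, 0 < x → uVec F x y = u y := fun x y hx => hF.uVec_eq hx ht₀.pos y
  have hvv : ∀ x y : ℝ, IsSmall x → vVec F x y = v₁ y := fun x y hx =>
    hF.vVec_eq hx.pos ht₀.pos hx.q_pos ht₀.q_pos y
  have hfA : ∀ x y : ℝ, 0 < x → f x y = radS y • fVec F x y + A y := fun x y hx =>
    sub_eq_iff_eq_add'.1 (hf.center_eq hx ht₀.pos y)
  have hdu : ∀ y : ℝ, HasDerivAt u ((y ^ 2 / (1 + y ^ 2)) • v₁ y) y :=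
    hF.hasDerivAt_uVec ht₀.pos ht₀.q_pos
  have hdv : ∀ y : ℝ, HasDerivAt v₁ (-((y ^ 2 / (1 + y ^ 2)) • u y)) y :=
    hF.hasDerivAt_vVec ht₀.pos ht₀.q_pos
  have hvc : Continuous v₁ := hF.continuous_vVec ht₀.pos ht₀.q_pos
  have hv1 : ∀ y, inner ℝ (v₁ y) (v₁ y) = (1 : ℝ) := hF.inner_v_v ht₀.pos ht₀.q_pos
  have huv : ∀ y, inner ℝ (v₁ y) (u y) = (0 : ℝ) := hF.inner_v_u ht₀.pos
  have hperp_u : inner ℝ b (u 0) = (0 : ℝ) ∧ inner ℝ c (u 0) = (0 : ℝ) := by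
    have e : ∀ t, uVec F (Real.exp (-t)) 0 = u 0 := fun t => huu _ 0 (Real.exp_pos _)
    refine hperp (u 0) (tendsto_const_nhds.congr fun t => ?_) (tendsto_const_nhds.congr fun t => ?_)
    · rw [← e t, hF.inner_Xα_u (Real.exp_pos _)]
    · rw [← e t, uVec, zVec]
      simp [inner_add_left, real_inner_smul_left, hF.inner_eq (Real.exp_pos (-t))]
  have hperp_v : inner ℝ b (v₁ 0) = (0 : ℝ) ∧ inner ℝ c (v₁ 0) = (0 : ℝ) := by
    have e : ∀ᶠ t in atTop, vVec F (Real.exp (-t)) 0 = v₁ 0 :=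
      eventually_isSmall.mono fun t ht => hvv _ 0 ht
    refine hperp (v₁ 0) ?_ (hF.tendsto_inner_z_v.congr' (e.mono fun t ht => by rw [ht]))
    have h0 : Tendsto (fun t => 2 * |X0p (Real.exp (-t))|) atTop (𝓝 0) := by
      simpa using tendsto_abs_X0p.const_mul 2
    refine squeeze_zero_norm' ((e.and eventually_isSmall).mono fun t ht => ?_) h0
    rw [← ht.1, hF.inner_Xα_v (Real.exp_pos _), norm_neg]
    exact nC_abs_le_two_mul ht.2 0
  have hbuv := inner_u_v_eq_zero hdu hdv hperp_u.1 hperp_v.1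
  have hcuv := inner_u_v_eq_zero hdu hdv hperp_u.2 hperp_v.2
  obtain ⟨E, hE, hle⟩ := exists_tendsto_zero_bound hF hX hZ
  have hE' : Tendsto (fun t => 30 * hErr (Real.exp (-t)) + E t + 4 * |X0p (Real.exp (-t))|) atTop
      (𝓝 0) := by
    simpa using ((tendsto_hErr.const_mul 30).add hE).add (tendsto_abs_X0p.const_mul 4)
  have hfa : ∀ᶠ t in atTop, ∀ y, ‖fVec F (Real.exp (-t)) y - aCirc b c v₁ t y‖
      ≤ 30 * hErr (Real.exp (-t)) + E t + 4 * |X0p (Real.exp (-t))| := by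
    filter_upwards [eventually_isSmall, hle] with t ht htE y
    have := norm_fVec_sub_le hF hb hc hbc ht (hvv _ y ht) t
    linarith [(htE y).2]
  have hAc : Continuous A :=
    (continuous_iff_continuousAt.2 fun y => (hf.deriv_y x₀ y ht₀.pos).continuousAt).sub
      (continuous_radS.smul (hF.continuous_fVec ht₀.pos))
  have hp2 : Continuous fun y => 2 / √5 * v2 0 y := continuous_const.mul continuous_v2_zero
  have hp3 : Continuous fun y => 2 / √5 * v3 0 y := continuous_const.mul continuous_v3_zero
  have hmem : ∀ y (p : E4), ‖p‖ = 1 → inner ℝ p (u y) = (0 : ℝ) →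
      radS y • p + A y ∈ sphere2 (A y) (u y) (radS y) := by
    intro y p hp hpu
    refine ⟨?_, ?_⟩
    · rw [dist_eq_norm, add_sub_cancel_right, norm_smul, hp, mul_one, Real.norm_eq_abs,
        abs_of_nonneg (radS_nonneg y)]
    · rw [add_sub_cancel_right, real_inner_smul_left, hpu, mul_zero]
  refine ⟨b, c, u, v₁, A, huu, hfA, fun x y hx => ?_, ⟨hvc, hdu, fun y => ?_⟩,
    ⟨.of_le hE (hle.mono fun t ht y => (ht y).1), ?_, .of_le hE' hfa, fun y => ?_, ?_, fun t => ?_⟩,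
    .of_le hE' (hfa.mono fun t ht y => ?_), fun y => ?_, fun t y => ?_, ?_, fun t => ?_⟩
  · rw [hfA x y hx]
    exact hmem y _ (hF.norm_f hx y) (by rw [← huu x y hx]; exact hF.inner_f_u hx y)
  · rw [orthonormal_iff_ite]
    have hu1 : ‖u y‖ = 1 := norm_eq_one_of_inner (hF.inner_u_u ht₀.pos y)
    have hv1 : ‖v₁ y‖ = 1 := norm_eq_one_of_inner (hv1 y)
    intro i j
    fin_cases i <;> fin_cases j <;>
      simp [hu1, hv1, hb, hc, huv, hbc, hbuv, hcuv, real_inner_comm (v₁ y) (u y),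
        real_inner_comm b (u y), real_inner_comm c (u y), real_inner_comm b (v₁ y),
        real_inner_comm c (v₁ y), real_inner_comm b c]
  · simpa using range_add_smul_bCirc hb hc hbc 0 1
  · simp only [aCirc_eq]
    rw [range_add_smul_v2Circ hb hc hbc, abs_mul,
      abs_of_nonneg (by positivity : (0 : ℝ) ≤ 2 / √5)]
  · rw [show aCirc b c v₁ = fun t y => -((2 / √5 * v2 0 y) • v₁ y)
      + (2 / √5 * v3 0 y) • v2Circ b c t from funext₂ (aCirc_eq b c v₁)]
    exact deformsContinuously_add_smul hb hc hbc (hp2.smul hvc).neg hp3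
  · rw [aCirc_eq, two_div_mul_v2_zero, v3_zero_zero]
    simp
  · rw [hfA _ y (Real.exp_pos _), Γ, add_sub_add_right_eq_sub, ← smul_sub, norm_smul,
      Real.norm_eq_abs, abs_of_nonneg (radS_nonneg y)]
    exact (mul_le_of_le_one_left (norm_nonneg _) (radS_le_one y)).trans (ht y)
  · simp only [Γ_eq]
    rw [range_add_smul_v2Circ hb hc hbc, abs_radS_mul]
  · refine hmem y _ (norm_aCirc hb hc hbc (hv1 y) (hbuv y).2 (hcuv y).2 t) ?_
    rw [aCirc_eq, inner_add_left, inner_neg_left, real_inner_smul_left, real_inner_smul_left,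
      huv, inner_v2Circ (hbuv y).1 (hcuv y).1]
    simp
  · rw [show Γ b c v₁ A = fun t y => (A y - (radS y * (2 / √5 * v2 0 y)) • v₁ y)
      + (radS y * (2 / √5 * v3 0 y)) • v2Circ b c t from funext₂ (Γ_eq b c v₁ A)]
    exact deformsContinuously_add_smul hb hc hbc
      (hAc.sub ((continuous_radS.mul hp2).smul hvc)) (continuous_radS.mul hp3)
  · rw [Γ_eq, two_div_mul_v2_zero, v3_zero_zero, radS_zero]
    module
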